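/- Consider a discrete memoryless two-way channel with finite input alphabets $\mathcal X_1,\mathcal X_2$, finite output alphabets $\mathcal Y_1,\mathcal Y_2$ and transition probability $P_{Y_1,Y_2|X_1,X_2}$, with marginal channels $P_{Y_1|X_1,X_2}$ and $P_{Y_2|X_1,X_2}$. Let $\mathcal P(\mathcal X)$ be the set of probability distributions on $\mathcal X$. All logarithms are to base $2$. An $(n,R_1,R_2)$ code ($R_1,R_2\ge 0$) has message sets $\mathcal M_j=\{1,\dots,\lfloor 2^{nR_j}\rfloor\}$, encoders $X_{j,i}=f_{j,i}(M_j,Y_j^{i-1})$ for $j=1,2$ and $1\le i\le n$, and decoders $\hat M_2=g_1(M_1,Y_1^n)$, $\hat M_1=g_2(M_2,Y_2^n)$. The messages $M_1,M_2$ are independent and uniform, and the error probability is $P_e^{(n)}=\Pr\{\hat M_1\ne M_1\text{ or }\hat M_2\ne M_2\}$. A pair $(R_1,R_2)$ of nonnegative reals is achievable if there is a sequence of $(n,R_1,R_2)$ codes with $P_e^{(n)}\to0$ as $n\to\infty$. The capacity region $\mathcal C$ is $\overline{\mathrm{co}}$ of the set of achievable pairs, where $\overline{\mathrm{co}}$ denotes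 the closure of the convex hull. For an input distribution $P_{X_1,X_2}$ let $$\mathcal R(P_{X_1,X_2})=\{(R_1,R_2): 0\le R_1\le I(X_1;Y_2|X_2),\ 0\le R_2\le I(X_2;Y_1|X_1)\},$$ and let $$\mathcal C_{\mathrm I}=\overline{\mathrm{co}}\Big(\bigcup_{P_{X_1},P_{X_2}}\mathcal R(P_{X_1}\cdot P_{X_2})\Big),\qquad \mathcal C_{\mathrm O}=\overline{\mathrm{co}}\Big(\bigcup_{P_{X_1,X_2}}\mathcal R(P_{X_1,X_2})\Big)$$ be Shannon's inner and outer bounds. **Theorem 4.** Suppose that there is $P^*_{X_1}\in\mathcal P(\mathcal X_1)$ such that both of the following conditions hold. (i) For every $x_2\in\mathcal X_2$, $P^*_{X_1}$ maximizes $I(X_1;Y_2|X_2=x_2)$ over all $P_{X_1|X_2=x_2}\in\mathcal P(\mathcal X_1)$ (it need not be the only maximizer). (ii) $H(Y_1|X_1,X_2)$ does not depend on $P_{X_1|X_2}$ given $P_{X_2}$; that is, it takes the same value for any two input distributions with the same marginal $P_{X_2}$. Moreover, for every input distribution $P^{(1)}_{X_1,X_2}$ with second marginal $P^{(1)}_{X_2}$,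 one has $H^{(1)}(Y_1|X_1)\le H^{(2)}(Y_1|X_1)$, where the two sides are evaluated under $P^{(1)}_{X_1,X_2}$ and under $P^{(2)}_{X_1,X_2}=P^*_{X_1}\cdot P^{(1)}_{X_2}$ respectively. Then $\mathcal C=\mathcal C_{\mathrm I}=\mathcal C_{\mathrm O}$, and $$\mathcal C=\overline{\mathrm{co}}\Big(\bigcup_{P_{X_2}\in\mathcal P(\mathcal X_2)}\mathcal R(P^*_{X_1}\cdot P_{X_2})\Big).$$ -/

import Mathlib

namespace TWC

/-- Probability distributions on a finite set `A`. -/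
abbrev ProbDist (A : Type*) [Fintype A] : Type _ := ↥(stdSimplex ℝ A)

/-- Product distribution `P · Q` of independent inputs. -/
def ProbDist.prod {A B : Type*} [Fintype A] [Fintype B] (P : ProbDist A) (Q : ProbDist B) :
    ProbDist (A × B) :=
  ⟨fun z => P.1 z.1 * Q.1 z.2, fun z => mul_nonneg (P.2.1 z.1) (Q.2.1 z.2), by
    rw [Fintype.sum_prod_type]
    simp only [← Finset.mul_sum, Q.2.2, mul_one, P.2.2]⟩

/-- Second marginal of a joint distribution. -/
def ProbDist.snd {A B : Type*} [Fintype A] [Fintype B] (P : ProbDist (A × B)) : ProbDist B :=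
  ⟨fun b => ∑ a, P.1 (a, b), fun b => Finset.sum_nonneg fun a _ => P.2.1 (a, b), by
    rw [← Fintype.sum_prod_type_right]
    exact P.2.2⟩

/-! ### Information quantities, in bits -/

/-- The functional `𝓘(P_X, P_{Y|X})`: mutual information between an input with distribution `P`
and the output of the channel with transition probability `V` (terms with `P x * V x y = 0`
contribute `0`). -/
noncomputable def mutualInfo {A B : Type*} [Fintype A] [Fintype B] (P : A → ℝ) (V : A → B → ℝ) :
    ℝ :=
  ∑ x, ∑ y, P x * V x y * Real.logb 2 (V x y / ∑ x', P x' * V x' y)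

/-- Conditional entropy `H(B | A)` under the joint probability mass function `p a b`. -/
noncomputable def condEntropy {A B : Type*} [Fintype A] [Fintype B] (p : A → B → ℝ) : ℝ :=
  -∑ a, ∑ b, p a b * Real.logb 2 (p a b / ∑ b', p a b')

/-- Conditional mutual information `I(A; B | C)` under the joint probability mass function
`p a b c`. -/
noncomputable def condMutualInfo {A B C : Type*} [Fintype A] [Fintype B] [Fintype C]
    (p : A → B → C → ℝ) : ℝ :=
  ∑ a, ∑ b, ∑ c, p a b c *
    Real.logb 2 ((p a b c * ∑ a', ∑ b', p a' b' c) / ((∑ b', p a b' c) * ∑ a', p a' b c))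

/-! ### Memoryless two-way channels -/

/-- Transition probability `P_{Y₁,Y₂|X₁,X₂}` of a memoryless two-way channel. -/
abbrev Channel (X₁ X₂ Y₁ Y₂ : Type*) [Fintype Y₁] [Fintype Y₂] := X₁ → X₂ → ProbDist (Y₁ × Y₂)

section Region

variable {X₁ X₂ Y₁ Y₂ : Type*} [Fintype X₁] [Fintype X₂] [Fintype Y₁] [Fintype Y₂]

/-- Marginal channel `P_{Y₁|X₁,X₂}`. -/
def Channel.toUser1 (W : Channel X₁ X₂ Y₁ Y₂) (x₁ : X₁) (x₂ : X₂) (y₁ : Y₁) : ℝ :=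
  ∑ y₂, (W x₁ x₂).1 (y₁, y₂)

/-- Marginal channel `P_{Y₂|X₁,X₂}`. -/
def Channel.toUser2 (W : Channel X₁ X₂ Y₁ Y₂) (x₁ : X₁) (x₂ : X₂) (y₂ : Y₂) : ℝ :=
  ∑ y₁, (W x₁ x₂).1 (y₁, y₂)

/-- `I(X₁; Y₂ | X₂)` under the input distribution `P`. -/
noncomputable def infoX1Y2 (P : ProbDist (X₁ × X₂)) (W : Channel X₁ X₂ Y₁ Y₂) : ℝ :=
  condMutualInfo fun (x₁ : X₁) (y₂ : Y₂) (x₂ : X₂) => P.1 (x₁, x₂) * W.toUser2 x₁ x₂ y₂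

/-- `I(X₂; Y₁ | X₁)` under the input distribution `P`. -/
noncomputable def infoX2Y1 (P : ProbDist (X₁ × X₂)) (W : Channel X₁ X₂ Y₁ Y₂) : ℝ :=
  condMutualInfo fun (x₂ : X₂) (y₁ : Y₁) (x₁ : X₁) => P.1 (x₁, x₂) * W.toUser1 x₁ x₂ y₁

/-- `H(Y₁ | X₁)` under the input distribution `P`. -/
noncomputable def entropyY1X1 (P : ProbDist (X₁ × X₂)) (W : Channel X₁ X₂ Y₁ Y₂) : ℝ :=
  condEntropy fun (x₁ : X₁) (y₁ : Y₁) => ∑ x₂, P.1 (x₁, x₂) * W.toUser1 x₁ x₂ y₁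

/-- `H(Y₁ | X₁, X₂)` under the input distribution `P`. -/
noncomputable def entropyY1X1X2 (P : ProbDist (X₁ × X₂)) (W : Channel X₁ X₂ Y₁ Y₂) : ℝ :=
  condEntropy fun (x : X₁ × X₂) (y₁ : Y₁) => P.1 x * W.toUser1 x.1 x.2 y₁

/-- The set `𝓡(P, W)` of (nonnegative) rate pairs. -/
def rateRegion (P : ProbDist (X₁ × X₂)) (W : Channel X₁ X₂ Y₁ Y₂) : Set (ℝ × ℝ) :=
  {R | 0 ≤ R.1 ∧ 0 ≤ R.2 ∧ R.1 ≤ infoX1Y2 P W ∧ R.2 ≤ infoX2Y1 P W}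

/-- Closure of the convex hull. -/
def coBar (S : Set (ℝ × ℝ)) : Set (ℝ × ℝ) := closure (convexHull ℝ S)

/-- Shannon's inner bound `𝓒_I`. -/
def innerBound (W : Channel X₁ X₂ Y₁ Y₂) : Set (ℝ × ℝ) :=
  coBar (⋃ (P₁ : ProbDist X₁) (P₂ : ProbDist X₂), rateRegion (P₁.prod P₂) W)

/-- Shannon's outer bound `𝓒_O`. -/
def outerBound (W : Channel X₁ X₂ Y₁ Y₂) : Set (ℝ × ℝ) :=
  coBar (⋃ P : ProbDist (X₁ × X₂), rateRegion P W)

end Region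

/-! ### Codes and the capacity region -/

/-- The number of integers in `{1, 2, …, 2^{nR}}`. -/
noncomputable def numMessages (n : ℕ) (R : ℝ) : ℕ := ⌊(2 : ℝ) ^ ((n : ℝ) * R)⌋₊

/-- An `(n, R₁, R₂)` code with feedback-adaptive encoders. At time `i` (counted from `0`) a user's
input depends on its own message and on the `i` outputs it has received before. -/
structure Code (X₁ X₂ Y₁ Y₂ : Type*) (n : ℕ) (R₁ R₂ : ℝ) where
  enc₁ : (i : Fin n) → Fin (numMessages n R₁) → (Fin i → Y₁) → X₁
  enc₂ : (i : Fin n) → Fin (numMessages n R₂) → (Fin i → Y₂) → X₂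
  /-- User 1's estimate of user 2's message. -/
  dec₁ : Fin (numMessages n R₁) → (Fin n → Y₁) → Fin (numMessages n R₂)
  /-- User 2's estimate of user 1's message. -/
  dec₂ : Fin (numMessages n R₂) → (Fin n → Y₂) → Fin (numMessages n R₁)

/-- The outputs strictly before time `i`. -/
def past {Y : Type*} {n : ℕ} (y : Fin n → Y) (i : Fin n) : Fin i → Y :=
  fun j => y (Fin.castLE i.isLt.le j)

section Capacity

variable {X₁ X₂ Y₁ Y₂ : Type*} [Fintype Y₁] [Fintype Y₂]

/-- Probability that the messages `m₁, m₂` produce the output sequences `y₁, y₂` over the memoryless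
channel `W`. -/
def Code.outputProb {n : ℕ} {R₁ R₂ : ℝ} (c : Code X₁ X₂ Y₁ Y₂ n R₁ R₂) (W : Channel X₁ X₂ Y₁ Y₂)
    (m₁ : Fin (numMessages n R₁)) (m₂ : Fin (numMessages n R₂))
    (y₁ : Fin n → Y₁) (y₂ : Fin n → Y₂) : ℝ :=
  ∏ i : Fin n, (W (c.enc₁ i m₁ (past y₁ i)) (c.enc₂ i m₂ (past y₂ i))).1 (y₁ i, y₂ i)

/-- Probability of decoding error for independent, uniformly distributed messages. -/
noncomputable def Code.errorProb {n : ℕ} {R₁ R₂ : ℝ} (c : Code X₁ X₂ Y₁ Y₂ n R₁ R₂)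
    (W : Channel X₁ X₂ Y₁ Y₂) : ℝ :=
  ∑ m₁, ∑ m₂, (numMessages n R₁ : ℝ)⁻¹ * (numMessages n R₂ : ℝ)⁻¹ *
    ∑ y₁ : Fin n → Y₁, ∑ y₂ : Fin n → Y₂,
      if c.dec₂ m₂ y₂ ≠ m₁ ∨ c.dec₁ m₁ y₁ ≠ m₂ then c.outputProb W m₁ m₂ y₁ y₂ else 0

/-- Achievability of a rate pair. -/
def Achievable (W : Channel X₁ X₂ Y₁ Y₂) (R : ℝ × ℝ) : Prop :=
  0 ≤ R.1 ∧ 0 ≤ R.2 ∧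
    ∃ c : (n : ℕ) → Code X₁ X₂ Y₁ Y₂ n R.1 R.2,
      Filter.Tendsto (fun n => (c n).errorProb W) Filter.atTop (nhds 0)

/-- The capacity region `𝓒`. -/
def capacityRegion (W : Channel X₁ X₂ Y₁ Y₂) : Set (ℝ × ℝ) :=
  coBar {R | Achievable W R}

end Capacity

end TWC

/-!
Converse. Under an arbitrary code, compare the law of the messages and of the outputs with a
reference law in which user 2 learns nothing about the message of user 1. The relative entropy of
the two is at least the rate of user 1, up to a Fano term, because user 2 decodes under the first
law and can only guess under the second; by Gibbs' inequality and the chain rule it is, for the best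
reference law, at most the sum over time of `I(X₁; Y₂ | X₂)` under the input laws which the code
induces. Hence each achievable pair is in `outerBound`.

Achievability. Random codebooks with independent letters, threshold decoding by the information
density and the weak law of large numbers give every pair strictly inside `rateRegion (P₁ · P₂)`.

Finally, (i) says that the first rate bound does not decrease, and (ii) that the second one does not
decrease, when the input law `P` is replaced with `P* · P_{X₂}`. So `outerBound` is already reached
by product laws of this special form.
-/

namespace TWC

namespace ProbDist

variable {A B C : Type*} [Fintype A] [Fintype B] [Fintype C]

/-- Expectation of a real function under a distribution on a finite set. -/
def expect (P : ProbDist A) (f : A → ℝ) : ℝ := ∑ a, P.1 a * f a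

theorem expect_const (P : ProbDist A) (r : ℝ) : (P.expect fun _ => r) = r := by
  rw [expect, ← Finset.sum_mul, P.2.2, one_mul]

theorem expect_add (P : ProbDist A) (f g : A → ℝ) :
    (P.expect fun a => f a + g a) = P.expect f + P.expect g := by
  simp only [expect, mul_add, Finset.sum_add_distrib]

theorem expect_sub (P : ProbDist A) (f g : A → ℝ) :
    (P.expect fun a => f a - g a) = P.expect f - P.expect g := by
  simp only [expect, mul_sub, Finset.sum_sub_distrib]

theorem expect_const_mul (P : ProbDist A) (r : ℝ) (f : A → ℝ) :
    (P.expect fun a => r * f a) = r * P.expect f := by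
  simp only [expect, Finset.mul_sum, mul_left_comm]

theorem expect_mul_const (P : ProbDist A) (f : A → ℝ) (r : ℝ) :
    (P.expect fun a => f a * r) = P.expect f * r := by
  simp only [expect, Finset.sum_mul, mul_assoc]

theorem expect_sum {ι : Type*} (P : ProbDist A) (s : Finset ι) (f : ι → A → ℝ) :
    (P.expect fun a => ∑ i ∈ s, f i a) = ∑ i ∈ s, P.expect (f i) := by
  simp only [expect, Finset.mul_sum]
  exact Finset.sum_comm

theorem expect_comm (P : ProbDist A) (Q : ProbDist B) (f : A → B → ℝ) :
    (P.expect fun a => Q.expect (f a)) = Q.expect fun b => P.expect fun a => f a b := by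
  simp only [expect, Finset.mul_sum, mul_left_comm]
  exact Finset.sum_comm

theorem expect_congr {P : ProbDist A} {f g : A → ℝ} (h : ∀ a, P.1 a ≠ 0 → f a = g a) :
    P.expect f = P.expect g :=
  Finset.sum_congr rfl fun a _ => by
    by_cases ha : P.1 a = 0
    · simp only [ha, zero_mul]
    · rw [h a ha]

theorem expect_mono {P : ProbDist A} {f g : A → ℝ} (h : ∀ a, P.1 a ≠ 0 → f a ≤ g a) :
    P.expect f ≤ P.expect g :=
  Finset.sum_le_sum fun a _ => by
    by_cases ha : P.1 a = 0
    · simp only [ha, zero_mul, le_refl]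
    · exact mul_le_mul_of_nonneg_left (h a ha) (P.2.1 a)

theorem expect_nonneg (P : ProbDist A) {f : A → ℝ} (h : ∀ a, 0 ≤ f a) : 0 ≤ P.expect f :=
  Finset.sum_nonneg fun a _ => mul_nonneg (P.2.1 a) (h a)

theorem exists_le_expect (P : ProbDist A) (f : A → ℝ) : ∃ a, f a ≤ P.expect f := by
  by_contra! h
  have hpos : ∑ a, P.1 a * P.expect f < ∑ a, P.1 a * f a := by
    obtain ⟨a, -, ha⟩ := Finset.exists_ne_zero_of_sum_ne_zero (P.2.2.trans_ne one_ne_zero)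
    exact Finset.sum_lt_sum (fun a _ => mul_le_mul_of_nonneg_left (h a).le (P.2.1 a))
      ⟨a, Finset.mem_univ a, mul_lt_mul_of_pos_left (h a) ((P.2.1 a).lt_of_ne' ha)⟩
  exact hpos.ne (P.expect_const _)

theorem ext_of_expect {P Q : ProbDist A} (h : ∀ f, P.expect f = Q.expect f) : P = Q := by
  classical
  refine Subtype.ext (funext fun a => ?_)
  simpa only [expect, Pi.single_apply, mul_ite, mul_one, mul_zero, Finset.sum_ite_eq',
    Finset.mem_univ, if_true] using h (Pi.single a 1)

/-- Probability of an event. -/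
noncomputable def prob (P : ProbDist A) (S : Set A) : ℝ := P.expect (S.indicator 1)

theorem prob_nonneg (P : ProbDist A) (S : Set A) : 0 ≤ P.prob S :=
  P.expect_nonneg fun _ => Set.indicator_nonneg (fun _ _ => zero_le_one) _

theorem prob_le_one (P : ProbDist A) (S : Set A) : P.prob S ≤ 1 :=
  (expect_mono fun _ _ => Set.indicator_le_self' (fun _ _ => zero_le_one) _).trans_eq
    (P.expect_const 1)

theorem prob_mono {P : ProbDist A} {S T : Set A} (h : ∀ a, P.1 a ≠ 0 → a ∈ S → a ∈ T) :
    P.prob S ≤ P.prob T :=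
  expect_mono fun a ha => by
    by_cases hS : a ∈ S
    · rw [Set.indicator_of_mem hS, Set.indicator_of_mem (h a ha hS)]
    · rw [Set.indicator_of_notMem hS]
      exact Set.indicator_nonneg (fun _ _ => zero_le_one) _

theorem prob_compl (P : ProbDist A) (S : Set A) : P.prob Sᶜ = 1 - P.prob S := by
  rw [prob, prob, Set.indicator_compl, ← P.expect_const 1, ← expect_sub]
  rfl

theorem prob_union_le (P : ProbDist A) (S T : Set A) :
    P.prob (S ∪ T) ≤ P.prob S + P.prob T := by
  rw [prob, prob, prob, ← expect_add]
  refine expect_mono fun a _ => ?_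
  by_cases hS : a ∈ S <;> by_cases hT : a ∈ T <;> simp [hS, hT]

theorem prob_le_expect (P : ProbDist A) {S : Set A} {f : A → ℝ} (hf : ∀ a, 0 ≤ f a)
    (hS : ∀ a ∈ S, 1 ≤ f a) : P.prob S ≤ P.expect f :=
  expect_mono fun a _ => Set.indicator_le' hS (fun a _ => hf a) a

/-- Law of a pair whose first entry has law `P` and whose second entry has conditional law `κ`. -/
def joint (P : ProbDist A) (κ : A → ProbDist B) : ProbDist (A × B) :=
  ⟨fun z => P.1 z.1 * (κ z.1).1 z.2, fun z => mul_nonneg (P.2.1 _) ((κ _).2.1 _), by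
    simp only [Fintype.sum_prod_type, ← Finset.mul_sum, (κ _).2.2, mul_one, P.2.2]⟩

/-- Output law of the channel `κ` when its input has law `P`. -/
def bind (P : ProbDist A) (κ : A → ProbDist B) : ProbDist B := (P.joint κ).snd

/-- Law of a pair with its entries exchanged. -/
def swap (P : ProbDist (A × B)) : ProbDist (B × A) :=
  ⟨fun z => P.1 z.swap, fun z => P.2.1 z.swap,
    ((Equiv.prodComm B A).sum_comp P.1).trans P.2.2⟩

/-- Uniform distribution. -/
noncomputable def uniform (A : Type*) [Fintype A] [Nonempty A] : ProbDist A :=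
  stdSimplex.barycenter

theorem expect_joint (P : ProbDist A) (κ : A → ProbDist B) (f : A × B → ℝ) :
    (P.joint κ).expect f = P.expect fun a => (κ a).expect fun b => f (a, b) := by
  simp only [expect, joint, Fintype.sum_prod_type, Finset.mul_sum, mul_assoc]

theorem expect_prod (P : ProbDist A) (Q : ProbDist B) (f : A × B → ℝ) :
    (P.prod Q).expect f = P.expect fun a => Q.expect fun b => f (a, b) :=
  expect_joint P (fun _ => Q) f

theorem expect_swap (P : ProbDist (A × B)) (f : B × A → ℝ) :
    P.swap.expect f = P.expect fun z => f z.swap :=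
  ((Equiv.prodComm A B).sum_comp _).symm

theorem expect_snd (P : ProbDist (A × B)) (f : B → ℝ) :
    P.snd.expect f = P.expect fun z => f z.2 := by
  simp only [expect, snd, Finset.sum_mul, Fintype.sum_prod_type_right]

theorem map_apply [DecidableEq B] (f : A → B) (P : ProbDist A) (b : B) :
    (stdSimplex.map f P).1 b = ∑ a with f a = b, P.1 a :=
  FunOnFinite.linearMap_apply_apply ℝ ℝ f P.1 b

theorem expect_map (f : A → B) (P : ProbDist A) (g : B → ℝ) :
    expect (stdSimplex.map f P) g = P.expect fun a => g (f a) := by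
  classical
  rw [expect, expect, ← Finset.sum_fiberwise Finset.univ f]
  refine Finset.sum_congr rfl fun b _ => ?_
  rw [map_apply, Finset.sum_mul]
  exact Finset.sum_congr rfl fun a ha => by rw [(Finset.mem_filter.1 ha).2]

theorem map_apply_ne_zero (f : A → B) {P : ProbDist A} {a : A} (ha : P.1 a ≠ 0) :
    (stdSimplex.map f P).1 (f a) ≠ 0 := by
  classical
  rw [map_apply]
  exact (Finset.sum_pos' (fun a' _ => P.2.1 a')
    ⟨a, by simp only [Finset.mem_filter_univ], (P.2.1 a).lt_of_ne' ha⟩).ne'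

theorem snd_apply_ne_zero {P : ProbDist (A × B)} {a : A} {b : B} (h : P.1 (a, b) ≠ 0) :
    P.snd.1 b ≠ 0 :=
  (Finset.sum_pos' (fun a _ => P.2.1 (a, b)) ⟨a, Finset.mem_univ a, (P.2.1 _).lt_of_ne' h⟩).ne'

theorem bind_apply_ne_zero {P : ProbDist A} {κ : A → ProbDist B} {a : A} {b : B}
    (ha : P.1 a ≠ 0) (hb : (κ a).1 b ≠ 0) : (P.bind κ).1 b ≠ 0 :=
  snd_apply_ne_zero (P := P.joint κ) (mul_ne_zero ha hb)

theorem snd_prod (P : ProbDist A) (Q : ProbDist B) : (P.prod Q).snd = Q := by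
  ext b
  change ∑ a, P.1 a * Q.1 b = Q.1 b
  rw [← Finset.sum_mul, P.2.2, one_mul]

theorem swap_prod (P : ProbDist A) (Q : ProbDist B) : (P.prod Q).swap = Q.prod P :=
  Subtype.ext (funext fun _ => mul_comm _ _)

open Classical in
/-- Conditional law of the first entry of a pair given the second one; given an event of
probability zero it is, arbitrarily, the marginal law of the first entry. -/
noncomputable def condFst (P : ProbDist (A × B)) (b : B) : ProbDist A :=
  if h : P.snd.1 b = 0 then P.swap.snd else
    ⟨fun a => P.1 (a, b) / P.snd.1 b, fun a => div_nonneg (P.2.1 _) (P.snd.2.1 b), by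
      rw [← Finset.sum_div]
      exact div_self h⟩

theorem snd_mul_condFst (P : ProbDist (A × B)) (a : A) (b : B) :
    P.snd.1 b * (P.condFst b).1 a = P.1 (a, b) := by
  by_cases h : P.snd.1 b = 0
  · rw [h, zero_mul]
    by_contra h'
    exact snd_apply_ne_zero (Ne.symm h') h
  · rw [condFst, dif_neg h]
    exact mul_div_cancel₀ _ h

theorem swap_joint_condFst (P : ProbDist (A × B)) : (P.snd.joint P.condFst).swap = P := by
  ext ⟨a, b⟩
  exact P.snd_mul_condFst a b

theorem condFst_apply_ne_zero {P : ProbDist (A × B)} {a : A} {b : B} (h : P.1 (a, b) ≠ 0) :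
    (P.condFst b).1 a ≠ 0 := fun h0 => h (by rw [← P.snd_mul_condFst, h0, mul_zero])

end ProbDist

section RelativeEntropy

variable {A : Type*} [Fintype A]

theorem sum_mul_logb_div_nonneg {p r : A → ℝ} (hp : ∀ a, 0 ≤ p a) (hr : ∀ a, 0 ≤ r a)
    (hpr : ∀ a, p a ≠ 0 → r a ≠ 0) (hsum : ∑ a, r a ≤ ∑ a, p a) :
    0 ≤ ∑ a, p a * Real.logb 2 (p a / r a) := by
  have hlog : 0 < Real.log 2 := Real.log_pos one_lt_two
  have hpt (a : A) : (p a - r a) / Real.log 2 ≤ p a * Real.logb 2 (p a / r a) := by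
    rw [Real.logb, mul_div_assoc', div_le_div_iff_of_pos_right hlog]
    by_cases ha : p a = 0
    · simpa only [ha, zero_sub, zero_mul, neg_nonpos] using hr a
    have hpos : 0 < p a := (hp a).lt_of_ne' ha
    calc p a - r a = p a * (1 - (p a / r a)⁻¹) := by field_simp
      _ ≤ p a * Real.log (p a / r a) := mul_le_mul_of_nonneg_left
          (Real.one_sub_inv_le_log_of_pos (div_pos hpos ((hr a).lt_of_ne' (hpr a ha)))) hpos.le
  calc 0 ≤ (∑ a, p a - ∑ a, r a) / Real.log 2 := div_nonneg (sub_nonneg.2 hsum) hlog.le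
    _ = ∑ a, (p a - r a) / Real.log 2 := by rw [← Finset.sum_sub_distrib, Finset.sum_div]
    _ ≤ ∑ a, p a * Real.logb 2 (p a / r a) := Finset.sum_le_sum fun a _ => hpt a

namespace ProbDist

/-- Relative entropy (Kullback–Leibler divergence) in bits. It is meaningful only when `Q` charges
every point that `P` charges: elsewhere `P a / 0 = 0` makes the summand vanish. -/
noncomputable def relEntropy (P Q : ProbDist A) : ℝ :=
  P.expect fun a => Real.logb 2 (P.1 a / Q.1 a)

theorem relEntropy_nonneg {P Q : ProbDist A} (hPQ : ∀ a, P.1 a ≠ 0 → Q.1 a ≠ 0) :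
    0 ≤ P.relEntropy Q :=
  sum_mul_logb_div_nonneg P.2.1 Q.2.1 hPQ (Q.2.2.trans P.2.2.symm).le

/-- Gibbs' inequality against `Q` reweighted by the factor `N / 2` on `S` and `1 / 2` elsewhere. -/
theorem prob_mul_logb_sub_one_le_relEntropy {P Q : ProbDist A}
    (hPQ : ∀ a, P.1 a ≠ 0 → Q.1 a ≠ 0) {S : Set A} {N : ℝ} (hN : 0 < N) (hS : N * Q.prob S ≤ 1) :
    P.prob S * Real.logb 2 N - 1 ≤ P.relEntropy Q := by
  classical
  set g : A → ℝ := fun a => (if a ∈ S then N else 1) / 2 with hg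
  have hg0 (a : A) : 0 < g a := by simp only [hg]; split_ifs <;> positivity
  have hlog (a : A) : Real.logb 2 (g a) = S.indicator 1 a * Real.logb 2 N - 1 := by
    by_cases ha : a ∈ S
    · simp [hg, ha, Real.logb_div hN.ne' two_ne_zero]
    · simp [hg, ha, Real.logb_inv]
  have hmass : Q.expect g ≤ 1 := by
    calc Q.expect g ≤ Q.expect fun a => N / 2 * S.indicator 1 a + 1 / 2 :=
          expect_mono fun a _ => by by_cases ha : a ∈ S <;> simp [hg, ha]
      _ = N * Q.prob S / 2 + 1 / 2 := by
          rw [expect_add, expect_const_mul, expect_const, prob, div_mul_eq_mul_div]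
      _ ≤ 1 := by linarith
  have hgibbs := sum_mul_logb_div_nonneg P.2.1 (r := fun a => Q.1 a * g a)
    (fun a => mul_nonneg (Q.2.1 a) (hg0 a).le) (fun a ha => mul_ne_zero (hPQ a ha) (hg0 a).ne')
    (hmass.trans P.2.2.ge)
  have hsplit : (P.expect fun a => Real.logb 2 (P.1 a / (Q.1 a * g a))) =
      P.relEntropy Q - (P.prob S * Real.logb 2 N - 1) := by
    rw [relEntropy, prob, ← expect_mul_const, ← P.expect_const 1, ← expect_sub, ← expect_sub]
    refine expect_congr fun a ha => ?_
    rw [← div_div, Real.logb_div (div_ne_zero ha (hPQ a ha)) (hg0 a).ne', hlog]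
  exact sub_nonneg.1 (hgibbs.trans_eq hsplit)

end ProbDist

end RelativeEntropy

section Information

variable {A B C : Type*} [Fintype A] [Fintype B] [Fintype C]

theorem condMutualInfo_eq_condEntropy_sub {p : A → B → C → ℝ} (hp : ∀ a b c, 0 ≤ p a b c) :
    condMutualInfo p = condEntropy (fun c b => ∑ a, p a b c) -
      condEntropy fun (x : C × A) b => p x.2 b x.1 := by
  have hmarginal : condEntropy (fun c b => ∑ a, p a b c) =
      -∑ a, ∑ b, ∑ c, p a b c * Real.logb 2 ((∑ a', p a' b c) / ∑ a', ∑ b', p a' b' c) := by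
    rw [condEntropy, Finset.sum_comm, neg_inj]
    simp only [Finset.sum_mul]
    rw [Finset.sum_congr rfl fun b _ => Finset.sum_comm, Finset.sum_comm]
    simp only [Finset.sum_comm (s := (Finset.univ : Finset B)) (t := (Finset.univ : Finset A))]
  have hfull : condEntropy (fun (x : C × A) b => p x.2 b x.1) =
      -∑ a, ∑ b, ∑ c, p a b c * Real.logb 2 (p a b c / ∑ b', p a b' c) := by
    rw [condEntropy, Fintype.sum_prod_type_right, neg_inj]
    exact Finset.sum_congr rfl fun a _ => Finset.sum_comm
  rw [hmarginal, hfull, neg_sub_neg, condMutualInfo]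
  simp only [← Finset.sum_sub_distrib]
  refine Finset.sum_congr rfl fun a _ => Finset.sum_congr rfl fun b _ =>
    Finset.sum_congr rfl fun c _ => ?_
  by_cases h : p a b c = 0
  · simp only [h, zero_mul, sub_zero]
  have hpos : 0 < p a b c := (hp a b c).lt_of_ne' h
  have hac : 0 < ∑ b', p a b' c :=
    Finset.sum_pos' (fun b' _ => hp a b' c) ⟨b, Finset.mem_univ b, hpos⟩
  have hbc : 0 < ∑ a', p a' b c :=
    Finset.sum_pos' (fun a' _ => hp a' b c) ⟨a, Finset.mem_univ a, hpos⟩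
  have hc : 0 < ∑ a', ∑ b', p a' b' c :=
    Finset.sum_pos' (fun a' _ => Finset.sum_nonneg fun b' _ => hp a' b' c)
      ⟨a, Finset.mem_univ a, hac⟩
  rw [Real.logb_div (mul_pos hpos hc).ne' (mul_pos hac hbc).ne', Real.logb_div hpos.ne' hac.ne',
    Real.logb_div hbc.ne' hc.ne', Real.logb_mul hpos.ne' hc.ne', Real.logb_mul hac.ne' hbc.ne']
  ring

theorem mutualInfo_eq_expect_relEntropy (P : ProbDist A) (V : A → ProbDist B) :
    mutualInfo P.1 (fun a => (V a).1) = P.expect fun a => (V a).relEntropy (P.bind V) := by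
  simp only [mutualInfo, ProbDist.relEntropy, ProbDist.expect, Finset.mul_sum, mul_assoc]
  rfl

theorem mutualInfo_nonneg (P : ProbDist A) (V : A → ProbDist B) :
    0 ≤ mutualInfo P.1 fun a => (V a).1 := by
  rw [mutualInfo_eq_expect_relEntropy, ← P.expect_const 0]
  exact ProbDist.expect_mono fun a ha => ProbDist.relEntropy_nonneg fun b =>
    ProbDist.bind_apply_ne_zero ha

theorem condMutualInfo_eq_expect_mutualInfo (q : ProbDist C) (κ : C → ProbDist A)
    (V : A → C → ProbDist B) :
    (condMutualInfo fun a b c => q.1 c * (κ c).1 a * (V a c).1 b) =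
      q.expect fun c => mutualInfo (κ c).1 fun a => (V a c).1 := by
  simp only [condMutualInfo, ProbDist.expect, mutualInfo, Finset.mul_sum]
  rw [Finset.sum_congr rfl fun a _ => Finset.sum_comm, Finset.sum_comm]
  refine Finset.sum_congr rfl fun c _ => Finset.sum_congr rfl fun a _ =>
    Finset.sum_congr rfl fun b _ => ?_
  by_cases hc : q.1 c = 0
  · simp only [hc, zero_mul]
  by_cases ha : (κ c).1 a = 0
  · simp only [ha, mul_zero, zero_mul]
  simp only [mul_assoc, ← Finset.mul_sum, (V _ c).2.2, (κ c).2.2, mul_one]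
  congr 3
  field_simp

end Information

section Channel

variable {X₁ X₂ Y₁ Y₂ : Type*} [Fintype X₁] [Fintype X₂] [Fintype Y₁] [Fintype Y₂]

/-- The two-way channel with the roles of its users exchanged. -/
def Channel.swap (W : Channel X₁ X₂ Y₁ Y₂) : Channel X₂ X₁ Y₂ Y₁ :=
  fun x₂ x₁ => (W x₁ x₂).swap

theorem infoX2Y1_eq_infoX1Y2_swap (P : ProbDist (X₁ × X₂)) (W : Channel X₁ X₂ Y₁ Y₂) :
    infoX2Y1 P W = infoX1Y2 P.swap W.swap := rfl

theorem infoX2Y1_eq_entropy_sub (P : ProbDist (X₁ × X₂)) (W : Channel X₁ X₂ Y₁ Y₂) :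
    infoX2Y1 P W = entropyY1X1 P W - entropyY1X1X2 P W :=
  condMutualInfo_eq_condEntropy_sub fun x₂ _ x₁ =>
    mul_nonneg (P.2.1 _) (Finset.sum_nonneg fun _ _ => (W x₁ x₂).2.1 _)

theorem infoX1Y2_swap_joint (q : ProbDist X₂) (κ : X₂ → ProbDist X₁) (W : Channel X₁ X₂ Y₁ Y₂) :
    infoX1Y2 (q.joint κ).swap W =
      q.expect fun x₂ => mutualInfo (κ x₂).1 fun x₁ => W.toUser2 x₁ x₂ :=
  condMutualInfo_eq_expect_mutualInfo q κ fun x₁ x₂ => (W x₁ x₂).snd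

theorem infoX1Y2_prod (P₁ : ProbDist X₁) (P₂ : ProbDist X₂) (W : Channel X₁ X₂ Y₁ Y₂) :
    infoX1Y2 (P₁.prod P₂) W = P₂.expect fun x₂ => mutualInfo P₁.1 fun x₁ => W.toUser2 x₁ x₂ := by
  rw [← ProbDist.swap_prod]
  exact infoX1Y2_swap_joint P₂ (fun _ => P₁) W

theorem infoX1Y2_eq_expect_mutualInfo (P : ProbDist (X₁ × X₂)) (W : Channel X₁ X₂ Y₁ Y₂) :
    infoX1Y2 P W =
      P.snd.expect fun x₂ => mutualInfo (P.condFst x₂).1 fun x₁ => W.toUser2 x₁ x₂ := by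
  rw [← infoX1Y2_swap_joint, P.swap_joint_condFst]

/-- `P_{Y₂|X₂}` under the input distribution `P`. -/
noncomputable def Channel.outputGivenX2 (W : Channel X₁ X₂ Y₁ Y₂) (P : ProbDist (X₁ × X₂))
    (x₂ : X₂) : ProbDist Y₂ :=
  (P.condFst x₂).bind fun x₁ => (W x₁ x₂).snd

theorem Channel.outputGivenX2_apply_ne_zero {W : Channel X₁ X₂ Y₁ Y₂} {P : ProbDist (X₁ × X₂)}
    {x : X₁ × X₂} {y : Y₁ × Y₂} (hx : P.1 x ≠ 0) (hy : (W x.1 x.2).1 y ≠ 0) :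
    (W.outputGivenX2 P x.2).1 y.2 ≠ 0 :=
  ProbDist.bind_apply_ne_zero (ProbDist.condFst_apply_ne_zero hx) (ProbDist.snd_apply_ne_zero hy)

theorem infoX1Y2_eq_expect_relEntropy (P : ProbDist (X₁ × X₂)) (W : Channel X₁ X₂ Y₁ Y₂) :
    infoX1Y2 P W =
      P.expect fun x => (W x.1 x.2).snd.relEntropy (W.outputGivenX2 P x.2) := by
  conv_rhs => rw [← P.swap_joint_condFst, ProbDist.expect_swap, ProbDist.expect_joint]
  rw [infoX1Y2_eq_expect_mutualInfo, P.swap_joint_condFst]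
  exact ProbDist.expect_congr fun x₂ _ =>
    mutualInfo_eq_expect_relEntropy (P.condFst x₂) fun x₁ => (W x₁ x₂).snd

theorem infoX1Y2_nonneg (P : ProbDist (X₁ × X₂)) (W : Channel X₁ X₂ Y₁ Y₂) :
    0 ≤ infoX1Y2 P W := by
  rw [infoX1Y2_eq_expect_mutualInfo]
  exact ProbDist.expect_nonneg _ fun x₂ => mutualInfo_nonneg _ fun x₁ => (W x₁ x₂).snd

theorem infoX2Y1_nonneg (P : ProbDist (X₁ × X₂)) (W : Channel X₁ X₂ Y₁ Y₂) :
    0 ≤ infoX2Y1 P W :=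
  infoX1Y2_nonneg P.swap W.swap

theorem infoX1Y2_le_of_maximizer {W : Channel X₁ X₂ Y₁ Y₂} {Pstar : ProbDist X₁}
    (hmax : ∀ (x₂ : X₂) (Q : ProbDist X₁),
      mutualInfo Q.1 (fun x₁ => W.toUser2 x₁ x₂) ≤ mutualInfo Pstar.1 (fun x₁ => W.toUser2 x₁ x₂))
    (P : ProbDist (X₁ × X₂)) : infoX1Y2 P W ≤ infoX1Y2 (Pstar.prod P.snd) W := by
  rw [infoX1Y2_eq_expect_mutualInfo, infoX1Y2_prod]
  exact ProbDist.expect_mono fun x₂ _ => hmax x₂ _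

theorem infoX2Y1_le_of_entropy_le {W : Channel X₁ X₂ Y₁ Y₂} {P Q : ProbDist (X₁ × X₂)}
    (h₁ : entropyY1X1 P W ≤ entropyY1X1 Q W) (h₁₂ : entropyY1X1X2 P W = entropyY1X1X2 Q W) :
    infoX2Y1 P W ≤ infoX2Y1 Q W := by
  rw [infoX2Y1_eq_entropy_sub, infoX2Y1_eq_entropy_sub, h₁₂]
  exact sub_le_sub_right h₁ _

theorem rateRegion_eq_Icc (P : ProbDist (X₁ × X₂)) (W : Channel X₁ X₂ Y₁ Y₂) :
    rateRegion P W = Set.Icc 0 (infoX1Y2 P W, infoX2Y1 P W) :=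
  Set.ext fun _ => and_assoc.symm

theorem rateRegion_subset_rateRegion {W : Channel X₁ X₂ Y₁ Y₂} {P Q : ProbDist (X₁ × X₂)}
    (h₁ : infoX1Y2 P W ≤ infoX1Y2 Q W) (h₂ : infoX2Y1 P W ≤ infoX2Y1 Q W) :
    rateRegion P W ⊆ rateRegion Q W := by
  rw [rateRegion_eq_Icc, rateRegion_eq_Icc]
  exact Set.Icc_subset_Icc_right ⟨h₁, h₂⟩

end Channel

theorem subset_coBar (S : Set (ℝ × ℝ)) : S ⊆ coBar S :=
  (subset_convexHull ℝ S).trans subset_closure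

theorem coBar_subset_coBar {S T : Set (ℝ × ℝ)} (h : S ⊆ coBar T) : coBar S ⊆ coBar T :=
  closure_minimal (convexHull_min h (convex_convexHull ℝ T).closure) isClosed_closure

section Causal

variable {Z : Type*} {n : ℕ}

theorem past_snoc_castSucc (z : Fin n → Z) (w : Z) (i : Fin n) :
    past (Fin.snoc z w : Fin (n + 1) → Z) i.castSucc = past z i := by
  funext j
  exact Fin.snoc_castSucc (α := fun _ => Z) w z (Fin.castLE i.isLt.le j)

theorem past_snoc_last (z : Fin n → Z) (w : Z) :
    past (Fin.snoc z w : Fin (n + 1) → Z) (Fin.last n) = z := by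
  funext j
  exact Fin.snoc_castSucc (α := fun _ => Z) w z j

theorem prod_past_snoc (k : (i : Fin (n + 1)) → (Fin i → Z) → Z → ℝ) (z : Fin n → Z) (w : Z) :
    ∏ i, k i (past (Fin.snoc z w : Fin (n + 1) → Z) i) ((Fin.snoc z w : Fin (n + 1) → Z) i) =
      (∏ i : Fin n, k i.castSucc (past z i) (z i)) * k (Fin.last n) z w := by
  rw [Fin.prod_univ_castSucc]
  simp only [past_snoc_castSucc, Fin.snoc_castSucc, Fin.snoc_last]
  rw [past_snoc_last]

variable [Fintype Z]

theorem sum_fin_succ_eq_sum_snoc (F : (Fin (n + 1) → Z) → ℝ) :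
    ∑ z, F z = ∑ z : Fin n → Z, ∑ w, F (Fin.snoc z w : Fin (n + 1) → Z) := by
  rw [← (Fin.snocEquiv fun _ : Fin (n + 1) => Z).sum_comp, Fintype.sum_prod_type_right]
  rfl

theorem sum_prod_past_eq_one (K : (i : Fin n) → (Fin i → Z) → ProbDist Z) :
    ∑ z : Fin n → Z, ∏ i, (K i (past z i)).1 (z i) = 1 := by
  induction n with
  | zero => simp only [Finset.univ_eq_empty, Finset.prod_empty, Finset.sum_const,
      Finset.card_univ, Fintype.card_unique, one_smul]
  | succ n ih =>
    rw [sum_fin_succ_eq_sum_snoc, ← ih fun i => K i.castSucc]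
    refine Finset.sum_congr rfl fun z _ => ?_
    simp only [prod_past_snoc fun i h w => (K i h).1 w, ← Finset.mul_sum]
    rw [(K (Fin.last n) z).2.2, mul_one]

namespace ProbDist

/-- Law of a sequence whose `i`-th entry has conditional law `K i h` given that the entries before
it form `h`. -/
def causal (K : (i : Fin n) → (Fin i → Z) → ProbDist Z) : ProbDist (Fin n → Z) :=
  ⟨fun z => ∏ i, (K i (past z i)).1 (z i), fun _ => Finset.prod_nonneg fun _ _ => (K _ _).2.1 _,
    sum_prod_past_eq_one K⟩

theorem expect_causal_succ (K : (i : Fin (n + 1)) → (Fin i → Z) → ProbDist Z)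
    (F : (Fin (n + 1) → Z) → ℝ) :
    (causal K).expect F = (causal fun i : Fin n => K i.castSucc).expect fun z =>
      expect (K (Fin.last n) z) fun w => F (Fin.snoc z w : Fin (n + 1) → Z) := by
  rw [expect, sum_fin_succ_eq_sum_snoc]
  refine Finset.sum_congr rfl fun z _ => ?_
  simp only [causal, prod_past_snoc fun i h w => (K i h).1 w, expect, Finset.mul_sum, mul_assoc]

theorem expect_causal (K : (i : Fin n) → (Fin i → Z) → ProbDist Z) (i : Fin n)
    (φ : (Fin i → Z) → Z → ℝ) :
    ((causal K).expect fun z => φ (past z i) (z i)) =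
      (causal K).expect fun z => (K i (past z i)).expect (φ (past z i)) := by
  induction n with
  | zero => exact i.elim0
  | succ n ih =>
    rw [expect_causal_succ, expect_causal_succ]
    induction i using Fin.lastCases with
    | last =>
      have hz (z : Fin n → Z) (w : Z) :
          (expect (K (Fin.last n) (past (Fin.snoc z w : Fin (n + 1) → Z) (Fin.last n)))
            (φ (past (Fin.snoc z w : Fin (n + 1) → Z) (Fin.last n)))) =
          expect (K (Fin.last n) z) (φ z) := by rw [past_snoc_last]
      have hφ (z : Fin n → Z) (w : Z) :
          φ (past (Fin.snoc z w : Fin (n + 1) → Z) (Fin.last n)) w = φ z w := by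
        rw [past_snoc_last]
      simp only [hz, hφ, Fin.snoc_last, expect_const]
    | cast i =>
      simp only [past_snoc_castSucc, Fin.snoc_castSucc, expect_const]
      exact ih (fun i : Fin n => K i.castSucc) i φ

end ProbDist

end Causal

section Codebook

variable {M₁ M₂ X₁ X₂ Y₁ Y₂ : Type*} [Fintype M₁] [Fintype M₂] [Nonempty M₁] [Nonempty M₂]
  [Fintype Y₁] [Fintype Y₂] (W : Channel X₁ X₂ Y₁ Y₂) (C₁ : M₁ → X₁) (C₂ : M₂ → X₂)

/-- Joint law of the messages and of the outputs when the messages are independent and uniform and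
the channel is used once, with the codewords of the messages as inputs. -/
noncomputable def Channel.codebookLaw : ProbDist ((M₁ × M₂) × (Y₁ × Y₂)) :=
  ((ProbDist.uniform M₁).prod (ProbDist.uniform M₂)).joint fun m => W (C₁ m.1) (C₂ m.2)

theorem Channel.expect_codebookLaw_swap (F : (M₂ × M₁) × (Y₂ × Y₁) → ℝ) :
    (W.swap.codebookLaw C₂ C₁).expect F =
      (W.codebookLaw C₁ C₂).expect fun ω => F (ω.1.swap, ω.2.swap) := by
  simp only [Channel.codebookLaw, ProbDist.expect_joint, ProbDist.expect_prod]
  rw [ProbDist.expect_comm]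
  simp only [Channel.swap, ProbDist.expect_swap, Prod.swap_prod_mk]

end Codebook

section Strategy

/-- A user's causal choice of inputs: the input at time `i` as a function of the outputs which the
user has received before. -/
abbrev Strategy (n : ℕ) (Y X : Type*) := (i : Fin n) → (Fin i → Y) → X

variable {X₁ X₂ Y₁ Y₂ : Type*} [Fintype Y₁] [Fintype Y₂] {n : ℕ}

/-- Law of the two output sequences when the users follow the strategies `f₁` and `f₂`. Thus the
`n` uses of `W` amount to a single use of a channel whose input letters are strategies. -/
def Channel.strategyLaw (W : Channel X₁ X₂ Y₁ Y₂) :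
    Channel (Strategy n Y₁ X₁) (Strategy n Y₂ X₂) (Fin n → Y₁) (Fin n → Y₂) :=
  fun f₁ f₂ => ⟨fun y => ∏ i, (W (f₁ i (past y.1 i)) (f₂ i (past y.2 i))).1 (y.1 i, y.2 i),
    fun _ => Finset.prod_nonneg fun _ _ => (W _ _).2.1 _,
    ((Equiv.arrowProdEquivProdArrow (Fin n) (fun _ => Y₁) (fun _ => Y₂)).sum_comp _).symm.trans
      (sum_prod_past_eq_one fun i (h : Fin i → Y₁ × Y₂) =>
        W (f₁ i fun j => (h j).1) (f₂ i fun j => (h j).2))⟩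

theorem Channel.expect_strategyLaw (W : Channel X₁ X₂ Y₁ Y₂) (f₁ : Strategy n Y₁ X₁)
    (f₂ : Strategy n Y₂ X₂) (i : Fin n) (φ : X₁ × X₂ → Y₁ × Y₂ → ℝ) :
    ((W.strategyLaw f₁ f₂).expect fun y =>
        φ (f₁ i (past y.1 i), f₂ i (past y.2 i)) (y.1 i, y.2 i)) =
      (W.strategyLaw f₁ f₂).expect fun y =>
        (W (f₁ i (past y.1 i)) (f₂ i (past y.2 i))).expect
          (φ (f₁ i (past y.1 i), f₂ i (past y.2 i))) := by
  have hcausal (F : (Fin n → Y₁) × (Fin n → Y₂) → ℝ) :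
      (W.strategyLaw f₁ f₂).expect F =
        (ProbDist.causal fun i (h : Fin i → Y₁ × Y₂) =>
          W (f₁ i fun j => (h j).1) (f₂ i fun j => (h j).2)).expect
            fun z => F (fun j => (z j).1, fun j => (z j).2) :=
    ((Equiv.arrowProdEquivProdArrow (Fin n) (fun _ => Y₁) (fun _ => Y₂)).sum_comp _).symm
  rw [hcausal, hcausal]
  exact ProbDist.expect_causal _ i fun (h : Fin i → Y₁ × Y₂) w =>
    φ (f₁ i fun j => (h j).1, f₂ i fun j => (h j).2) w

end Strategy

section Transmission

variable {M₁ M₂ X₁ X₂ Y₁ Y₂ : Type*} [Fintype M₁] [Fintype M₂] [Nonempty M₁] [Nonempty M₂]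
  [Fintype Y₁] [Fintype Y₂] {n : ℕ}

/-- The inputs `(X₁ᵢ, X₂ᵢ)` as a function of the messages and of the outputs. -/
def inputAt (e₁ : M₁ → Strategy n Y₁ X₁) (e₂ : M₂ → Strategy n Y₂ X₂) (i : Fin n)
    (ω : (M₁ × M₂) × (Fin n → Y₁) × (Fin n → Y₂)) : X₁ × X₂ :=
  (e₁ ω.1.1 i (past ω.2.1 i), e₂ ω.1.2 i (past ω.2.2 i))

variable (W : Channel X₁ X₂ Y₁ Y₂) (e₁ : M₁ → Strategy n Y₁ X₁) (e₂ : M₂ → Strategy n Y₂ X₂)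

/-- Joint law of the messages `(M₁, M₂)` and of the outputs `(Y₁ⁿ, Y₂ⁿ)` when the messages are
independent and uniform and the users encode them by the strategies `e₁` and `e₂`. -/
noncomputable def Channel.transmissionLaw : ProbDist ((M₁ × M₂) × (Fin n → Y₁) × (Fin n → Y₂)) :=
  W.strategyLaw.codebookLaw e₁ e₂

theorem Channel.expect_transmissionLaw_swap
    (F : (M₂ × M₁) × (Fin n → Y₂) × (Fin n → Y₁) → ℝ) :
    (W.swap.transmissionLaw e₂ e₁).expect F =
      (W.transmissionLaw e₁ e₂).expect fun ω => F (ω.1.swap, ω.2.swap) :=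
  W.strategyLaw.expect_codebookLaw_swap e₁ e₂ F

variable {W e₁ e₂} in
theorem Channel.transmissionLaw_apply_ne_zero {ω : (M₁ × M₂) × (Fin n → Y₁) × (Fin n → Y₂)}
    (hω : (W.transmissionLaw e₁ e₂).1 ω ≠ 0) (i : Fin n) :
    (W (inputAt e₁ e₂ i ω).1 (inputAt e₁ e₂ i ω).2).1 (ω.2.1 i, ω.2.2 i) ≠ 0 :=
  Finset.prod_ne_zero_iff.1 (right_ne_zero_of_mul hω) i (Finset.mem_univ i)

/-- Joint law of messages and outputs in which `Y₂ᵢ` is drawn from `Q i X₂ᵢ`, so that user 2 learns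
nothing about `M₁`, while `Y₁ⁿ` is drawn given the messages and `Y₂ⁿ` from the backward channel
`P_{Y₁|Y₂,X₁,X₂}`. -/
noncomputable def Channel.referenceLaw (Q : Fin n → X₂ → ProbDist Y₂) :
    ProbDist ((M₁ × M₂) × (Fin n → Y₁) × (Fin n → Y₂)) :=
  ((ProbDist.uniform M₁).prod (ProbDist.uniform M₂)).joint fun m =>
    ((ProbDist.causal fun i h => Q i (e₂ m.2 i h)).joint fun y₂ =>
      ProbDist.causal fun i h => (W (e₁ m.1 i h) (e₂ m.2 i (past y₂ i))).condFst (y₂ i)).swap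

theorem Channel.referenceLaw_apply (Q : Fin n → X₂ → ProbDist Y₂)
    (ω : (M₁ × M₂) × (Fin n → Y₁) × (Fin n → Y₂)) :
    (W.referenceLaw e₁ e₂ Q).1 ω =
      ((ProbDist.uniform M₁).prod (ProbDist.uniform M₂)).1 ω.1 *
        ∏ i, (Q i (inputAt e₁ e₂ i ω).2).1 (ω.2.2 i) *
          ((W (inputAt e₁ e₂ i ω).1 (inputAt e₁ e₂ i ω).2).condFst (ω.2.2 i)).1 (ω.2.1 i) := by
  rw [Finset.prod_mul_distrib]
  rfl

theorem Channel.referenceLaw_prob_decode (Q : Fin n → X₂ → ProbDist Y₂)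
    (dec : M₂ → (Fin n → Y₂) → M₁) :
    (W.referenceLaw e₁ e₂ Q).prob {ω | dec ω.1.2 ω.2.2 = ω.1.1} = (Fintype.card M₁ : ℝ)⁻¹ := by
  have hguess (m : M₁) : (ProbDist.uniform M₁).prob {m₁ | m = m₁} = (Fintype.card M₁ : ℝ)⁻¹ := by
    classical
    simp [ProbDist.prob, ProbDist.expect, ProbDist.uniform, Set.indicator_apply]
  calc (W.referenceLaw e₁ e₂ Q).prob {ω | dec ω.1.2 ω.2.2 = ω.1.1}
      = (ProbDist.uniform M₁).expect fun m₁ => (ProbDist.uniform M₂).expect fun m₂ =>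
          (ProbDist.causal fun i h => Q i (e₂ m₂ i h)).expect fun y₂ =>
            {m | dec m₂ y₂ = m}.indicator 1 m₁ := by
        simp only [ProbDist.prob, Channel.referenceLaw, ProbDist.expect_joint,
          ProbDist.expect_prod, ProbDist.expect_swap]
        exact ProbDist.expect_congr fun m₁ _ => ProbDist.expect_congr fun m₂ _ =>
          ProbDist.expect_congr fun y₂ _ =>
            ProbDist.expect_const _ ({m | dec m₂ y₂ = m}.indicator 1 m₁)
    _ = (ProbDist.uniform M₂).expect fun m₂ =>
          (ProbDist.causal fun i h => Q i (e₂ m₂ i h)).expect fun y₂ =>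
            (ProbDist.uniform M₁).prob {m | dec m₂ y₂ = m} := by
        rw [ProbDist.expect_comm]
        exact ProbDist.expect_congr fun m₂ _ => ProbDist.expect_comm _ _ _
    _ = (Fintype.card M₁ : ℝ)⁻¹ := by simp only [hguess, ProbDist.expect_const]

theorem Channel.transmissionLaw_div_referenceLaw (Q : Fin n → X₂ → ProbDist Y₂)
    {ω : (M₁ × M₂) × (Fin n → Y₁) × (Fin n → Y₂)}
    (hω : (W.transmissionLaw e₁ e₂).1 ω ≠ 0) :
    (W.transmissionLaw e₁ e₂).1 ω / (W.referenceLaw e₁ e₂ Q).1 ω =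
      ∏ i, (W (inputAt e₁ e₂ i ω).1 (inputAt e₁ e₂ i ω).2).snd.1 (ω.2.2 i) /
        (Q i (inputAt e₁ e₂ i ω).2).1 (ω.2.2 i) := by
  have htransmission : (W.transmissionLaw e₁ e₂).1 ω =
      ((ProbDist.uniform M₁).prod (ProbDist.uniform M₂)).1 ω.1 *
        ∏ i, (W (inputAt e₁ e₂ i ω).1 (inputAt e₁ e₂ i ω).2).1 (ω.2.1 i, ω.2.2 i) := rfl
  rw [Channel.referenceLaw_apply, htransmission, mul_div_mul_left _ _ (left_ne_zero_of_mul hω),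
    ← Finset.prod_div_distrib]
  refine Finset.prod_congr rfl fun i _ => ?_
  rw [← ProbDist.snd_mul_condFst, mul_div_mul_right]
  exact ProbDist.condFst_apply_ne_zero (Channel.transmissionLaw_apply_ne_zero hω i)

variable [Fintype X₁] [Fintype X₂]

/-- Joint law of the inputs `(X₁ᵢ, X₂ᵢ)`. -/
noncomputable def Channel.inputLaw (i : Fin n) : ProbDist (X₁ × X₂) :=
  stdSimplex.map (inputAt e₁ e₂ i) (W.transmissionLaw e₁ e₂)

theorem Channel.expect_transmissionLaw (i : Fin n) (φ : X₁ × X₂ → Y₁ × Y₂ → ℝ) :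
    ((W.transmissionLaw e₁ e₂).expect fun ω => φ (inputAt e₁ e₂ i ω) (ω.2.1 i, ω.2.2 i)) =
      (W.inputLaw e₁ e₂ i).expect fun x => (W x.1 x.2).expect (φ x) := by
  rw [Channel.inputLaw, ProbDist.expect_map, Channel.transmissionLaw, Channel.codebookLaw,
    ProbDist.expect_joint, ProbDist.expect_joint]
  exact ProbDist.expect_congr fun m _ => W.expect_strategyLaw (e₁ m.1) (e₂ m.2) i φ

theorem Channel.inputLaw_swap (i : Fin n) :
    W.swap.inputLaw e₂ e₁ i = (W.inputLaw e₁ e₂ i).swap :=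
  ProbDist.ext_of_expect fun f => by
    rw [ProbDist.expect_swap, Channel.inputLaw, Channel.inputLaw, ProbDist.expect_map,
      ProbDist.expect_map, Channel.expect_transmissionLaw_swap]
    rfl

variable {W e₁ e₂} in
theorem Channel.outputGivenX2_inputLaw_apply_ne_zero
    {ω : (M₁ × M₂) × (Fin n → Y₁) × (Fin n → Y₂)} (hω : (W.transmissionLaw e₁ e₂).1 ω ≠ 0)
    (i : Fin n) :
    (W.outputGivenX2 (W.inputLaw e₁ e₂ i) (inputAt e₁ e₂ i ω).2).1 (ω.2.2 i) ≠ 0 :=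
  Channel.outputGivenX2_apply_ne_zero (ProbDist.map_apply_ne_zero _ hω)
    (Channel.transmissionLaw_apply_ne_zero hω i)

theorem Channel.referenceLaw_apply_ne_zero {ω : (M₁ × M₂) × (Fin n → Y₁) × (Fin n → Y₂)}
    (hω : (W.transmissionLaw e₁ e₂).1 ω ≠ 0) :
    (W.referenceLaw e₁ e₂ fun i => W.outputGivenX2 (W.inputLaw e₁ e₂ i)).1 ω ≠ 0 := by
  rw [Channel.referenceLaw_apply]
  exact mul_ne_zero (left_ne_zero_of_mul hω) <| Finset.prod_ne_zero_iff.2 fun i _ =>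
    mul_ne_zero (Channel.outputGivenX2_inputLaw_apply_ne_zero hω i)
      (ProbDist.condFst_apply_ne_zero (Channel.transmissionLaw_apply_ne_zero hω i))

theorem Channel.relEntropy_transmissionLaw_referenceLaw :
    (W.transmissionLaw e₁ e₂).relEntropy
        (W.referenceLaw e₁ e₂ fun i => W.outputGivenX2 (W.inputLaw e₁ e₂ i)) =
      ∑ i, infoX1Y2 (W.inputLaw e₁ e₂ i) W := by
  set Q := fun i => W.outputGivenX2 (W.inputLaw e₁ e₂ i) with hQ
  calc (W.transmissionLaw e₁ e₂).relEntropy (W.referenceLaw e₁ e₂ Q)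
      = (W.transmissionLaw e₁ e₂).expect fun ω => ∑ i, Real.logb 2
          ((W (inputAt e₁ e₂ i ω).1 (inputAt e₁ e₂ i ω).2).snd.1 (ω.2.2 i) /
            (Q i (inputAt e₁ e₂ i ω).2).1 (ω.2.2 i)) := ProbDist.expect_congr fun ω hω => by
        rw [W.transmissionLaw_div_referenceLaw e₁ e₂ Q hω, Real.logb_prod]
        exact fun i _ => div_ne_zero
          (ProbDist.snd_apply_ne_zero (Channel.transmissionLaw_apply_ne_zero hω i))
          (Channel.outputGivenX2_inputLaw_apply_ne_zero hω i)
    _ = ∑ i, (W.inputLaw e₁ e₂ i).expect fun x => (W x.1 x.2).expect fun y =>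
          Real.logb 2 ((W x.1 x.2).snd.1 y.2 / (Q i x.2).1 y.2) := by
        rw [ProbDist.expect_sum]
        exact Finset.sum_congr rfl fun i _ => W.expect_transmissionLaw e₁ e₂ i fun x y =>
          Real.logb 2 ((W x.1 x.2).snd.1 y.2 / (Q i x.2).1 y.2)
    _ = ∑ i, infoX1Y2 (W.inputLaw e₁ e₂ i) W := by
        simp only [infoX1Y2_eq_expect_relEntropy, ProbDist.relEntropy, ProbDist.expect_snd, hQ]

theorem Channel.prob_decode₂_mul_logb_card_sub_one_le (dec : M₂ → (Fin n → Y₂) → M₁) :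
    (W.transmissionLaw e₁ e₂).prob {ω | dec ω.1.2 ω.2.2 = ω.1.1} * Real.logb 2 (Fintype.card M₁) -
        1 ≤ ∑ i, infoX1Y2 (W.inputLaw e₁ e₂ i) W := by
  have hcard : (0 : ℝ) < Fintype.card M₁ := Nat.cast_pos.2 Fintype.card_pos
  rw [← Channel.relEntropy_transmissionLaw_referenceLaw]
  refine ProbDist.prob_mul_logb_sub_one_le_relEntropy
    (fun ω => W.referenceLaw_apply_ne_zero e₁ e₂) hcard ?_
  rw [Channel.referenceLaw_prob_decode, mul_inv_cancel₀ hcard.ne']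

theorem Channel.prob_decode₁_mul_logb_card_sub_one_le (dec : M₁ → (Fin n → Y₁) → M₂) :
    (W.transmissionLaw e₁ e₂).prob {ω | dec ω.1.1 ω.2.1 = ω.1.2} * Real.logb 2 (Fintype.card M₂) -
        1 ≤ ∑ i, infoX2Y1 (W.inputLaw e₁ e₂ i) W := by
  have h := W.swap.prob_decode₂_mul_logb_card_sub_one_le e₂ e₁ dec
  rw [ProbDist.prob, Channel.expect_transmissionLaw_swap] at h
  simp only [Channel.inputLaw_swap] at h
  exact h

end Transmission

section Average

variable {ι : Type*} [Fintype ι]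

theorem exists_le_and_sum_eq {α : ι → ℝ} (hα : 0 ≤ α) {a : ℝ} (ha : 0 ≤ a) (h : a ≤ ∑ i, α i) :
    ∃ s, 0 ≤ s ∧ s ≤ α ∧ ∑ i, s i = a := by
  have hsum : 0 ≤ ∑ i, α i := Finset.sum_nonneg fun i _ => hα i
  refine ⟨fun i => a / (∑ j, α j) * α i, fun i => mul_nonneg (div_nonneg ha hsum) (hα i),
    fun i => mul_le_of_le_one_left (hα i) (div_le_one_of_le₀ h hsum), ?_⟩
  rw [← Finset.mul_sum]
  exact div_mul_cancel_of_imp fun h0 => le_antisymm (h.trans_eq h0) ha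

theorem mem_convexHull_of_card_smul_le_sum [Nonempty ι] {S : Set (ℝ × ℝ)} {v : ι → ℝ × ℝ}
    (hv : 0 ≤ v) (hS : ∀ i, Set.Icc 0 (v i) ⊆ S) {r : ℝ × ℝ} (hr : 0 ≤ r)
    (hrv : (Fintype.card ι : ℝ) • r ≤ ∑ i, v i) : r ∈ convexHull ℝ S := by
  have hcard : (0 : ℝ) < Fintype.card ι := Nat.cast_pos.2 Fintype.card_pos
  obtain ⟨s, hs₀, hsv, hs⟩ := exists_le_and_sum_eq (fun i => (hv i).1)
    (mul_nonneg hcard.le hr.1) (hrv.1.trans_eq Prod.fst_sum)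
  obtain ⟨t, ht₀, htv, ht⟩ := exists_le_and_sum_eq (fun i => (hv i).2)
    (mul_nonneg hcard.le hr.2) (hrv.2.trans_eq Prod.snd_sum)
  have haverage : ∑ i, (Fintype.card ι : ℝ)⁻¹ • (s i, t i) = r := by
    rw [← Finset.smul_sum, ← prod_mk_sum, hs, ht]
    exact inv_smul_smul₀ hcard.ne' r
  rw [← haverage]
  refine (convex_convexHull ℝ S).sum_mem (fun _ _ => inv_nonneg.2 hcard.le) ?_ fun i _ =>
    subset_convexHull ℝ S (hS i ⟨⟨hs₀ i, ht₀ i⟩, ⟨hsv i, htv i⟩⟩)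
  rw [Finset.sum_const, Finset.card_univ, nsmul_eq_mul, mul_inv_cancel₀ hcard.ne']

end Average

section NumMessages

variable {n : ℕ} {R : ℝ}

theorem nonempty_fin_numMessages (n : ℕ) (hR : 0 ≤ R) : Nonempty (Fin (numMessages n R)) :=
  Fin.pos_iff_nonempty.1 <|
    Nat.floor_pos.2 (Real.one_le_rpow one_le_two (mul_nonneg n.cast_nonneg hR))

theorem mul_sub_one_le_mul_logb_numMessages [Nonempty (Fin (numMessages n R))] {p q : ℝ}
    (hq : 0 ≤ q) (hqp : q ≤ p) :
    q * (n * R - 1) ≤ p * Real.logb 2 (Fintype.card (Fin (numMessages n R))) := by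
  rw [Fintype.card_fin]
  have hone : (1 : ℝ) ≤ numMessages n R :=
    Nat.one_le_cast.2 (Fin.pos_iff_nonempty.2 inferInstance)
  have hlog : n * R - 1 ≤ Real.logb 2 (numMessages n R) := by
    have hfloor : (2 : ℝ) ^ ((n : ℝ) * R) < numMessages n R + 1 := Nat.lt_floor_add_one _
    rw [Real.le_logb_iff_rpow_le one_lt_two (by linarith), Real.rpow_sub two_pos, Real.rpow_one]
    linarith
  exact (mul_le_mul_of_nonneg_left hlog hq).trans
    (mul_le_mul_of_nonneg_right hqp (Real.logb_nonneg one_lt_two hone))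

end NumMessages

namespace Code

variable {X₁ X₂ Y₁ Y₂ : Type*} {n : ℕ} {R₁ R₂ : ℝ}

/-- User 1's strategy for sending the message `m`. -/
def strategy₁ (c : Code X₁ X₂ Y₁ Y₂ n R₁ R₂) (m : Fin (numMessages n R₁)) : Strategy n Y₁ X₁ :=
  fun i => c.enc₁ i m

/-- User 2's strategy for sending the message `m`. -/
def strategy₂ (c : Code X₁ X₂ Y₁ Y₂ n R₁ R₂) (m : Fin (numMessages n R₂)) : Strategy n Y₂ X₂ :=
  fun i => c.enc₂ i m

variable [Nonempty (Fin (numMessages n R₁))] [Nonempty (Fin (numMessages n R₂))]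
  [Fintype Y₁] [Fintype Y₂] (c : Code X₁ X₂ Y₁ Y₂ n R₁ R₂) (W : Channel X₁ X₂ Y₁ Y₂)

theorem errorProb_eq_prob :
    c.errorProb W = (W.transmissionLaw c.strategy₁ c.strategy₂).prob
      {ω | c.dec₂ ω.1.2 ω.2.2 ≠ ω.1.1 ∨ c.dec₁ ω.1.1 ω.2.1 ≠ ω.1.2} := by
  have huniform (N : ℕ) [Nonempty (Fin N)] (m : Fin N) :
      (ProbDist.uniform (Fin N)).1 m = (N : ℝ)⁻¹ := by
    simp [ProbDist.uniform]
  rw [errorProb, ProbDist.prob, Channel.transmissionLaw, Channel.codebookLaw,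
    ProbDist.expect_joint, ProbDist.expect_prod]
  simp only [ProbDist.expect, huniform, Finset.mul_sum, Fintype.sum_prod_type]
  classical
  refine Finset.sum_congr rfl fun m₁ _ => Finset.sum_congr rfl fun m₂ _ =>
    Finset.sum_congr rfl fun y₁ _ => Finset.sum_congr rfl fun y₂ _ => ?_
  rw [mul_assoc]
  congr 2
  rw [Set.indicator_apply, Pi.one_apply, mul_ite, mul_one, mul_zero]
  rfl

theorem one_sub_errorProb_le_prob_decode₂ :
    1 - c.errorProb W ≤ (W.transmissionLaw c.strategy₁ c.strategy₂).prob
      {ω | c.dec₂ ω.1.2 ω.2.2 = ω.1.1} := by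
  rw [errorProb_eq_prob, ← ProbDist.prob_compl]
  exact ProbDist.prob_mono fun ω _ hω => by_contra fun h => hω (Or.inl h)

theorem one_sub_errorProb_le_prob_decode₁ :
    1 - c.errorProb W ≤ (W.transmissionLaw c.strategy₁ c.strategy₂).prob
      {ω | c.dec₁ ω.1.1 ω.2.1 = ω.1.2} := by
  rw [errorProb_eq_prob, ← ProbDist.prob_compl]
  exact ProbDist.prob_mono fun ω _ hω => by_contra fun h => hω (Or.inr h)

theorem one_sub_errorProb_nonneg : 0 ≤ 1 - c.errorProb W := by
  rw [errorProb_eq_prob]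
  exact sub_nonneg.2 (ProbDist.prob_le_one _ _)

variable [Fintype X₁] [Fintype X₂]

theorem one_sub_errorProb_mul_le_sum_infoX1Y2 :
    (1 - c.errorProb W) * (n * R₁ - 1) - 1 ≤
      ∑ i, infoX1Y2 (W.inputLaw c.strategy₁ c.strategy₂ i) W :=
  (sub_le_sub_right (mul_sub_one_le_mul_logb_numMessages (c.one_sub_errorProb_nonneg W)
      (c.one_sub_errorProb_le_prob_decode₂ W)) 1).trans
    (W.prob_decode₂_mul_logb_card_sub_one_le c.strategy₁ c.strategy₂ c.dec₂)

theorem one_sub_errorProb_mul_le_sum_infoX2Y1 :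
    (1 - c.errorProb W) * (n * R₂ - 1) - 1 ≤
      ∑ i, infoX2Y1 (W.inputLaw c.strategy₁ c.strategy₂ i) W :=
  (sub_le_sub_right (mul_sub_one_le_mul_logb_numMessages (c.one_sub_errorProb_nonneg W)
      (c.one_sub_errorProb_le_prob_decode₁ W)) 1).trans
    (W.prob_decode₁_mul_logb_card_sub_one_le c.strategy₁ c.strategy₂ c.dec₁)

end Code

open Filter Topology

/-- The rate which Fano's inequality guarantees for a code of length `n`, error probability `e` and
nominal rate `R`; the value `n = 0` is junk. -/
noncomputable def fanoRate (n : ℕ) (e R : ℝ) : ℝ :=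
  max 0 (((1 - e) * (n * R - 1) - 1) / n)

theorem tendsto_fanoRate {e : ℕ → ℝ} (he : Tendsto e atTop (𝓝 0)) {R : ℝ} (hR : 0 ≤ R) :
    Tendsto (fun n => fanoRate n (e n) R) atTop (𝓝 R) := by
  have hinv : Tendsto (fun n : ℕ => (n : ℝ)⁻¹) atTop (𝓝 0) := tendsto_inv_atTop_nhds_zero_nat
  have hlim : Tendsto (fun n : ℕ => max 0 ((1 - e n) * (R - (n : ℝ)⁻¹) - (n : ℝ)⁻¹)) atTop
      (𝓝 (max 0 ((1 - 0) * (R - 0) - 0))) :=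
    tendsto_const_nhds.max
      (((tendsto_const_nhds.sub he).mul (tendsto_const_nhds.sub hinv)).sub hinv)
  rw [sub_zero, sub_zero, sub_zero, one_mul, max_eq_right hR] at hlim
  refine hlim.congr' ?_
  filter_upwards [eventually_ne_atTop 0] with n hn
  rw [fanoRate]
  field_simp

theorem mul_fanoRate_le {n : ℕ} (hn : n ≠ 0) {e R s : ℝ} (hs : 0 ≤ s)
    (h : (1 - e) * (n * R - 1) - 1 ≤ s) : n * fanoRate n e R ≤ s := by
  have hn' : (0 : ℝ) < n := Nat.cast_pos.2 hn.bot_lt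
  rw [fanoRate, mul_max_of_nonneg _ _ hn'.le, mul_zero, mul_div_cancel₀ _ hn'.ne']
  exact max_le hs h

section Capacity

variable {X₁ X₂ Y₁ Y₂ : Type*} [Fintype X₁] [Fintype X₂] [Fintype Y₁] [Fintype Y₂]

theorem Code.fanoRate_mem_convexHull {n : ℕ} (hn : n ≠ 0) {R₁ R₂ : ℝ}
    [Nonempty (Fin (numMessages n R₁))] [Nonempty (Fin (numMessages n R₂))]
    (c : Code X₁ X₂ Y₁ Y₂ n R₁ R₂) (W : Channel X₁ X₂ Y₁ Y₂) :
    (fanoRate n (c.errorProb W) R₁, fanoRate n (c.errorProb W) R₂) ∈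
      convexHull ℝ (⋃ P, rateRegion P W) := by
  have : Nonempty (Fin n) := Fin.pos_iff_nonempty.1 hn.bot_lt
  set P := W.inputLaw c.strategy₁ c.strategy₂
  have h₁ : 0 ≤ ∑ i, infoX1Y2 (P i) W := Finset.sum_nonneg fun i _ => infoX1Y2_nonneg _ _
  have h₂ : 0 ≤ ∑ i, infoX2Y1 (P i) W := Finset.sum_nonneg fun i _ => infoX2Y1_nonneg _ _
  refine mem_convexHull_of_card_smul_le_sum (v := fun i => (infoX1Y2 (P i) W, infoX2Y1 (P i) W))
    (fun i => ⟨infoX1Y2_nonneg _ _, infoX2Y1_nonneg _ _⟩) (fun i => ?_)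
    ⟨le_max_left _ _, le_max_left _ _⟩ ?_
  · rw [← rateRegion_eq_Icc]
    exact Set.subset_iUnion (fun P => rateRegion P W) (P i)
  · rw [Fintype.card_fin, ← prod_mk_sum]
    exact ⟨mul_fanoRate_le hn h₁ (c.one_sub_errorProb_mul_le_sum_infoX1Y2 W),
      mul_fanoRate_le hn h₂ (c.one_sub_errorProb_mul_le_sum_infoX2Y1 W)⟩

theorem Achievable.mem_outerBound {W : Channel X₁ X₂ Y₁ Y₂} {R : ℝ × ℝ} (h : Achievable W R) :
    R ∈ outerBound W := by
  obtain ⟨h₁, h₂, c, hc⟩ := h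
  refine mem_closure_of_tendsto ((tendsto_fanoRate hc h₁).prodMk_nhds (tendsto_fanoRate hc h₂)) ?_
  filter_upwards [eventually_ne_atTop 0] with n hn
  have := nonempty_fin_numMessages n h₁
  have := nonempty_fin_numMessages n h₂
  exact (c n).fanoRate_mem_convexHull hn W

theorem capacityRegion_subset_outerBound (W : Channel X₁ X₂ Y₁ Y₂) :
    capacityRegion W ⊆ outerBound W :=
  coBar_subset_coBar fun _ hR => Achievable.mem_outerBound hR

end Capacity

namespace ProbDist

section Pi

variable {ι A : Type*} [Fintype ι] [DecidableEq ι] [Fintype A]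

/-- Law of a family of independent entries, the `i`-th one having law `P i`. -/
def pi (P : ι → ProbDist A) : ProbDist (ι → A) :=
  ⟨fun a => ∏ i, (P i).1 (a i), fun _ => Finset.prod_nonneg fun i _ => (P i).2.1 _, by
    rw [← Fintype.piFinset_univ, ← Finset.prod_univ_sum]
    exact Finset.prod_eq_one fun i _ => (P i).2.2⟩

theorem expect_pi (P : ι → ProbDist A) (k : ι) (F : (ι → A) → ℝ) :
    (pi P).expect F = (P k).expect fun x => (pi fun i : {i // i ≠ k} => P i).expect fun a =>
      F ((Equiv.funSplitAt k A).symm (x, a)) := by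
  rw [expect, ← (Equiv.funSplitAt k A).symm.sum_comp, Fintype.sum_prod_type]
  simp only [expect, Finset.mul_sum]
  refine Finset.sum_congr rfl fun x _ => Finset.sum_congr rfl fun a _ => ?_
  have hne (i : {i // i ≠ k}) : (Equiv.funSplitAt k A).symm (x, a) i = a i := by
    simp [i.2]
  simp only [pi, Fintype.prod_eq_mul_prod_subtype_ne _ k, hne, mul_assoc]
  simp

theorem expect_pi_eval (P : ι → ProbDist A) (k : ι) (f : A → ℝ) :
    ((pi P).expect fun a => f (a k)) = (P k).expect f := by
  rw [expect_pi P k]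
  simp [expect_const]

theorem expect_pi_eval_eval (P : ι → ProbDist A) {k l : ι} (hkl : k ≠ l) (f : A → A → ℝ) :
    ((pi P).expect fun a => f (a k) (a l)) = (P k).expect fun x => (P l).expect (f x) := by
  rw [expect_pi P k]
  refine expect_congr fun x _ => ?_
  rw [← expect_pi_eval (fun i : {i // i ≠ k} => P i) ⟨l, hkl.symm⟩ (f x)]
  simp [hkl.symm]

theorem expect_pi_sum_sq {P : ProbDist A} {f : A → ℝ} (hf : P.expect f = 0) :
    ((pi fun _ : ι => P).expect fun a => (∑ i, f (a i)) ^ 2) =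
      Fintype.card ι * P.expect fun x => f x ^ 2 := by
  have hcov (k l : ι) : ((pi fun _ : ι => P).expect fun a => f (a k) * f (a l)) =
      if k = l then P.expect fun x => f x ^ 2 else 0 := by
    split_ifs with hkl
    · simp only [hkl, ← sq]
      exact expect_pi_eval (fun _ => P) l fun x => f x ^ 2
    · rw [expect_pi_eval_eval _ hkl fun x y => f x * f y]
      simp only [expect_const_mul, hf, mul_zero, expect_const]
  simp only [sq, Finset.sum_mul_sum, expect_sum] at hcov ⊢
  simp only [hcov, Finset.sum_ite_eq, Finset.mem_univ, if_true, Finset.sum_const,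
    Finset.card_univ, nsmul_eq_mul]

theorem prob_pi_sum_le [Nonempty ι] (P : ProbDist A) (f : A → ℝ) {t : ℝ} (ht : t < P.expect f) :
    (pi fun _ : ι => P).prob {a | ∑ i, f (a i) ≤ Fintype.card ι * t} ≤
      (P.expect fun x => (f x - P.expect f) ^ 2) / (P.expect f - t) ^ 2 *
        (Fintype.card ι : ℝ)⁻¹ := by
  have hn : (0 : ℝ) < Fintype.card ι := Nat.cast_pos.2 Fintype.card_pos
  have hδ : 0 < P.expect f - t := sub_pos.2 ht
  have hcentered : (P.expect fun x => f x - P.expect f) = 0 := by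
    rw [expect_sub, expect_const, sub_self]
  calc (pi fun _ : ι => P).prob {a | ∑ i, f (a i) ≤ Fintype.card ι * t}
      ≤ (pi fun _ : ι => P).expect fun a =>
          (∑ i, (f (a i) - P.expect f)) ^ 2 * ((Fintype.card ι * (P.expect f - t)) ^ 2)⁻¹ := by
        refine prob_le_expect _ (fun _ => by positivity) fun a ha => ?_
        rw [← div_eq_mul_inv, one_le_div (by positivity), sq_le_sq, abs_of_pos (mul_pos hn hδ),
          Finset.sum_sub_distrib, Finset.sum_const, Finset.card_univ, nsmul_eq_mul]
        exact le_trans (by linarith [show ∑ i, f (a i) ≤ Fintype.card ι * t from ha]) (neg_le_abs _)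
    _ = _ := by
        rw [expect_mul_const, expect_pi_sum_sq hcentered]
        field_simp

theorem tendsto_prob_pi_sum_le (P : ProbDist A) (f : A → ℝ) {t : ℝ} (ht : t < P.expect f) :
    Tendsto (fun n : ℕ => (pi fun _ : Fin n => P).prob {a | ∑ i, f (a i) ≤ n * t}) atTop
      (𝓝 0) := by
  have hlim := (tendsto_inv_atTop_nhds_zero_nat (𝕜 := ℝ)).const_mul
    ((P.expect fun x => (f x - P.expect f) ^ 2) / (P.expect f - t) ^ 2)
  rw [mul_zero] at hlim
  refine squeeze_zero' (Eventually.of_forall fun n => prob_nonneg _ _) ?_ hlim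
  filter_upwards [eventually_gt_atTop 0] with n hn
  have : Nonempty (Fin n) := Fin.pos_iff_nonempty.1 hn
  have h := prob_pi_sum_le (ι := Fin n) P f ht
  rwa [Fintype.card_fin] at h

end Pi

theorem prob_finset_biUnion_le {ι A : Type*} [Fintype A] (P : ProbDist A) (s : Finset ι)
    (S : ι → Set A) : P.prob (⋃ i ∈ s, S i) ≤ ∑ i ∈ s, P.prob (S i) := by
  classical
  induction s using Finset.induction_on with
  | empty => simp [prob, expect_const]
  | insert i s hi ih =>
    rw [Finset.set_biUnion_insert, Finset.sum_insert hi]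
    exact (P.prob_union_le _ _).trans (add_le_add_right ih _)

theorem prob_bind {A B : Type*} [Fintype A] [Fintype B] (P : ProbDist A) (κ : A → ProbDist B)
    (S : Set B) : (P.bind κ).prob S = P.expect fun a => (κ a).prob S := by
  rw [prob, bind, expect_snd, expect_joint]
  rfl

theorem prob_mul_lt_le_inv {A : Type*} [Fintype A] (P Q : ProbDist A) {θ : ℝ} (hθ : 0 < θ) :
    Q.prob {a | θ * Q.1 a < P.1 a} ≤ θ⁻¹ := by
  rw [prob, ← mul_one θ⁻¹, ← P.2.2, Finset.mul_sum]
  refine Finset.sum_le_sum fun a _ => ?_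
  by_cases ha : a ∈ {a | θ * Q.1 a < P.1 a}
  · rw [Set.indicator_of_mem ha, Pi.one_apply, mul_one, ← div_eq_inv_mul, le_div_iff₀' hθ]
    exact ha.le
  · rw [Set.indicator_of_notMem ha, mul_zero]
    exact mul_nonneg (inv_nonneg.2 hθ.le) (P.2.1 a)

end ProbDist

section RandomCoding

variable {A D ι : Type*} [Fintype A] [Fintype D] [Nonempty ι]

open Classical in
/-- Threshold decoding: look for a message whose codeword gives the output `d` a likelihood above
`θ` times the probability of `d` when the input has law `P`. -/
noncomputable def thresholdDecoder (P : ProbDist A) (V : A → ProbDist D) (θ : ℝ) (C : ι → A)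
    (d : D) : ι :=
  if h : ∃ m, θ * (P.bind V).1 d < (V (C m)).1 d then h.choose else Classical.arbitrary ι

/-- Probability that the likelihood of the output given the input does not exceed `θ` times the
output probability. -/
noncomputable def thresholdFailure (P : ProbDist A) (V : A → ProbDist D) (θ : ℝ) : ℝ :=
  P.expect fun a => (V a).prob {d | (V a).1 d ≤ θ * (P.bind V).1 d}

variable [Fintype ι] [DecidableEq ι] (P : ProbDist A) (V : A → ProbDist D) {θ : ℝ}

theorem prob_thresholdDecoder_ne_le (θ : ℝ) (C : ι → A) (m : ι) :
    (V (C m)).prob {d | thresholdDecoder P V θ C d ≠ m} ≤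
      (V (C m)).prob {d | (V (C m)).1 d ≤ θ * (P.bind V).1 d} +
        ∑ l ∈ Finset.univ.erase m, (V (C m)).prob {d | θ * (P.bind V).1 d < (V (C l)).1 d} := by
  refine le_trans (ProbDist.prob_mono fun d _ hd => ?_) <|
    (ProbDist.prob_union_le _ _ _).trans <|
      add_le_add_right (ProbDist.prob_finset_biUnion_le _ _ _) _
  refine or_iff_not_imp_left.2 fun hm => ?_
  have hex : ∃ l, θ * (P.bind V).1 d < (V (C l)).1 d := ⟨m, not_le.1 hm⟩
  have hchoose : thresholdDecoder P V θ C d = hex.choose := dif_pos hex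
  exact Set.mem_biUnion (Finset.mem_coe.2
    (Finset.mem_erase.2 ⟨hchoose ▸ hd, Finset.mem_univ _⟩)) hex.choose_spec

theorem expect_prob_thresholdDecoder_ne_le (hθ : 0 < θ) (m : ι) :
    ((ProbDist.pi fun _ : ι => P).expect fun C =>
        (V (C m)).prob {d | thresholdDecoder P V θ C d ≠ m}) ≤
      thresholdFailure P V θ + (Fintype.card ι - 1) * θ⁻¹ := by
  have hconfusion (l : ι) (hl : l ∈ Finset.univ.erase m) :
      ((ProbDist.pi fun _ : ι => P).expect fun C =>
        (V (C m)).prob {d | θ * (P.bind V).1 d < (V (C l)).1 d}) ≤ θ⁻¹ := by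
    rw [ProbDist.expect_pi_eval_eval _ (Finset.ne_of_mem_erase hl) fun a a' =>
      (V a').prob {d | θ * (P.bind V).1 d < (V a).1 d}]
    refine (ProbDist.expect_mono fun a _ => ?_).trans_eq (P.expect_const θ⁻¹)
    rw [← ProbDist.prob_bind]
    exact ProbDist.prob_mul_lt_le_inv _ _ hθ
  refine (ProbDist.expect_mono fun C _ => prob_thresholdDecoder_ne_le P V θ C m).trans ?_
  rw [ProbDist.expect_add, ProbDist.expect_sum, ProbDist.expect_pi_eval (fun _ => P) m fun a =>
    (V a).prob {d | (V a).1 d ≤ θ * (P.bind V).1 d}]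
  refine add_le_add_right ((Finset.sum_le_card_nsmul _ _ _ hconfusion).trans_eq ?_) _
  rw [nsmul_eq_mul, Finset.card_erase_of_mem (Finset.mem_univ m), Finset.card_univ,
    Nat.cast_pred Fintype.card_pos]

end RandomCoding

section TwoUsers

variable {M₁ M₂ X₁ X₂ Y₁ Y₂ : Type*} [Fintype X₁] [Fintype Y₁] [Fintype Y₂]
  (W : Channel X₁ X₂ Y₁ Y₂)

/-- Threshold decoding by user 2, who knows its own message. By exchanging the users it also
describes the decoding by user 1. -/
noncomputable def Channel.decoder [Nonempty M₁] (P₁ : ProbDist X₁) (θ : ℝ) (C₁ : M₁ → X₁)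
    (C₂ : M₂ → X₂) (l : M₂) : Y₂ → M₁ :=
  thresholdDecoder P₁ (fun x₁ => (W x₁ (C₂ l)).snd) θ C₁

variable [Fintype X₂]

/-- Probability that the information density at user 2, who knows its own input, does not exceed
`logb 2 θ`, when the inputs are independent with laws `P₁` and `P₂`. -/
noncomputable def Channel.thresholdFailure (P₁ : ProbDist X₁) (P₂ : ProbDist X₂) (θ : ℝ) : ℝ :=
  P₂.expect fun x₂ => TWC.thresholdFailure P₁ (fun x₁ => (W x₁ x₂).snd) θ

variable [Fintype M₁] [Fintype M₂] [Nonempty M₁] [Nonempty M₂]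
  (P₁ : ProbDist X₁) (P₂ : ProbDist X₂) {θ η : ℝ}

theorem Channel.expect_prob_decoder_ne_le [DecidableEq M₁] [DecidableEq M₂] (hθ : 0 < θ) :
    ((ProbDist.pi fun _ : M₁ => P₁).prod (ProbDist.pi fun _ : M₂ => P₂)).expect (fun C =>
        (W.codebookLaw C.1 C.2).prob {ω | W.decoder P₁ θ C.1 C.2 ω.1.2 ω.2.2 ≠ ω.1.1}) ≤
      W.thresholdFailure P₁ P₂ θ + (Fintype.card M₁ - 1) * θ⁻¹ := by
  have hmessages (C : (M₁ → X₁) × (M₂ → X₂)) :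
      (W.codebookLaw C.1 C.2).prob {ω | W.decoder P₁ θ C.1 C.2 ω.1.2 ω.2.2 ≠ ω.1.1} =
        ((ProbDist.uniform M₁).prod (ProbDist.uniform M₂)).expect fun m =>
          (W (C.1 m.1) (C.2 m.2)).snd.prob {d | W.decoder P₁ θ C.1 C.2 m.2 d ≠ m.1} := by
    simp only [ProbDist.prob, Channel.codebookLaw, ProbDist.expect_joint, ProbDist.expect_snd]
    rfl
  simp only [hmessages]
  rw [ProbDist.expect_comm]
  refine (ProbDist.expect_mono fun m _ => ?_).trans_eq (ProbDist.expect_const _ _)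
  rw [ProbDist.expect_prod, ProbDist.expect_comm]
  refine (ProbDist.expect_mono fun C₂ _ => expect_prob_thresholdDecoder_ne_le P₁
    (fun x₁ => (W x₁ (C₂ m.2)).snd) hθ m.1).trans_eq ?_
  rw [ProbDist.expect_add, ProbDist.expect_const, ProbDist.expect_pi_eval (fun _ => P₂) m.2
    fun x₂ => TWC.thresholdFailure P₁ (fun x₁ => (W x₁ x₂).snd) θ]
  rfl

theorem Channel.expect_prob_swap_decoder_ne_le [DecidableEq M₁] [DecidableEq M₂] (hη : 0 < η) :
    ((ProbDist.pi fun _ : M₁ => P₁).prod (ProbDist.pi fun _ : M₂ => P₂)).expect (fun C =>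
        (W.codebookLaw C.1 C.2).prob {ω | W.swap.decoder P₂ η C.2 C.1 ω.1.1 ω.2.1 ≠ ω.1.2}) ≤
      W.swap.thresholdFailure P₂ P₁ η + (Fintype.card M₂ - 1) * η⁻¹ := by
  refine le_of_eq_of_le ?_ (W.swap.expect_prob_decoder_ne_le (M₁ := M₂) (M₂ := M₁) P₂ P₁ hη)
  rw [ProbDist.expect_prod, ProbDist.expect_prod, ProbDist.expect_comm]
  simp only [ProbDist.prob, W.expect_codebookLaw_swap]
  rfl

theorem Channel.exists_codebooks (hθ : 0 < θ) (hη : 0 < η) :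
    ∃ (C₁ : M₁ → X₁) (C₂ : M₂ → X₂), (W.codebookLaw C₁ C₂).prob
        {ω | W.decoder P₁ θ C₁ C₂ ω.1.2 ω.2.2 ≠ ω.1.1 ∨
          W.swap.decoder P₂ η C₂ C₁ ω.1.1 ω.2.1 ≠ ω.1.2} ≤
      (W.thresholdFailure P₁ P₂ θ + (Fintype.card M₁ - 1) * θ⁻¹) +
        (W.swap.thresholdFailure P₂ P₁ η + (Fintype.card M₂ - 1) * η⁻¹) := by
  classical
  obtain ⟨C, hC⟩ := ProbDist.exists_le_expect
    ((ProbDist.pi fun _ : M₁ => P₁).prod (ProbDist.pi fun _ : M₂ => P₂)) fun C =>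
      (W.codebookLaw C.1 C.2).prob {ω | W.decoder P₁ θ C.1 C.2 ω.1.2 ω.2.2 ≠ ω.1.1 ∨
        W.swap.decoder P₂ η C.2 C.1 ω.1.1 ω.2.1 ≠ ω.1.2}
  refine ⟨C.1, C.2, hC.trans <|
    (ProbDist.expect_mono fun _ _ => ProbDist.prob_union_le _ _ _).trans ?_⟩
  rw [ProbDist.expect_add]
  exact add_le_add (W.expect_prob_decoder_ne_le P₁ P₂ hθ)
    (W.expect_prob_swap_decoder_ne_le P₁ P₂ hη)

end TwoUsers

namespace ProbDist

variable {ι A B : Type*} [Fintype ι] [DecidableEq ι] [Fintype A] [Fintype B]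

theorem apply_ne_zero_of_pi {P : ι → ProbDist A} {a : ι → A} (h : (pi P).1 a ≠ 0) (i : ι) :
    (P i).1 (a i) ≠ 0 :=
  (Finset.prod_ne_zero_iff (s := Finset.univ)).1 h i (Finset.mem_univ i)

theorem expect_pi_joint (P : ι → ProbDist A) (κ : ι → A → ProbDist B)
    (F : (ι → A) → (ι → B) → ℝ) :
    ((pi P).expect fun a => (pi fun i => κ i (a i)).expect (F a)) =
      (pi fun i => (P i).joint (κ i)).expect fun z => F (fun i => (z i).1) fun i => (z i).2 := by
  rw [expect, expect, ← (Equiv.arrowProdEquivProdArrow ι (fun _ => A) fun _ => B).symm.sum_comp,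
    Fintype.sum_prod_type]
  simp only [expect, Finset.mul_sum, ← mul_assoc, pi, ← Finset.prod_mul_distrib]
  rfl

theorem expect_pi_snd (P : ι → ProbDist (A × B)) (F : (ι → B) → ℝ) :
    (pi fun i => (P i).snd).expect F = (pi P).expect fun z => F fun i => (z i).2 := by
  have hval (b : ι → B) : (pi fun i => (P i).snd).1 b = ∑ a : ι → A, ∏ i, (P i).1 (a i, b i) :=
    (Finset.prod_univ_sum (fun _ => Finset.univ) fun i a => (P i).1 (a, b i)).trans
      (by rw [Fintype.piFinset_univ])
  simp only [expect, hval, Finset.sum_mul]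
  rw [← (Equiv.arrowProdEquivProdArrow ι (fun _ => A) fun _ => B).symm.sum_comp,
    Fintype.sum_prod_type_right]
  rfl

theorem bind_pi (P : ι → ProbDist A) (κ : ι → A → ProbDist B) :
    ((pi P).bind fun a => pi fun i => κ i (a i)) = pi fun i => (P i).bind (κ i) := by
  refine ext_of_expect fun F => ?_
  rw [bind, expect_snd, expect_joint, expect_pi_joint P κ fun _ => F]
  exact (expect_pi_snd _ F).symm

end ProbDist

section Block

variable {X₁ X₂ Y₁ Y₂ : Type*} [Fintype Y₁] [Fintype Y₂] {n : ℕ} (W : Channel X₁ X₂ Y₁ Y₂)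

/-- The channel whose single use consists of `n` uses of `W`, without feedback. -/
def Channel.block (n : ℕ) : Channel (Fin n → X₁) (Fin n → X₂) (Fin n → Y₁) (Fin n → Y₂) :=
  fun x₁ x₂ => W.strategyLaw (fun i _ => x₁ i) fun i _ => x₂ i

theorem Channel.swap_block : (W.block n).swap = W.swap.block n := rfl

theorem Channel.snd_block (x₁ : Fin n → X₁) (x₂ : Fin n → X₂) :
    (W.block n x₁ x₂).snd = ProbDist.pi fun i => (W (x₁ i) (x₂ i)).snd := by
  refine ProbDist.ext_of_expect fun F => ?_
  rw [ProbDist.expect_snd, ProbDist.expect_pi_snd]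
  exact ((Equiv.arrowProdEquivProdArrow (Fin n) (fun _ => Y₁) fun _ => Y₂).sum_comp _).symm

variable [Fintype X₁] [Fintype X₂]

/-- Information density at user 2 of an input pair and output, given the input of user 2. -/
noncomputable def Channel.infoDensity (P₁ : ProbDist X₁) (z : X₂ × X₁ × Y₂) : ℝ :=
  Real.logb 2 ((W z.2.1 z.1).snd.1 z.2.2 / (P₁.bind fun x₁ => (W x₁ z.1).snd).1 z.2.2)

/-- Joint law of the two inputs and of the output at user 2. -/
def Channel.lawAtUser2 (P₁ : ProbDist X₁) (P₂ : ProbDist X₂) : ProbDist (X₂ × X₁ × Y₂) :=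
  P₂.joint fun x₂ => P₁.joint fun x₁ => (W x₁ x₂).snd

theorem Channel.expect_infoDensity (P₁ : ProbDist X₁) (P₂ : ProbDist X₂) :
    (W.lawAtUser2 P₁ P₂).expect (W.infoDensity P₁) = infoX1Y2 (P₁.prod P₂) W := by
  rw [infoX1Y2_prod, Channel.lawAtUser2, ProbDist.expect_joint]
  simp only [ProbDist.expect_joint]
  refine ProbDist.expect_congr fun x₂ _ => ?_
  exact (mutualInfo_eq_expect_relEntropy P₁ fun x₁ => (W x₁ x₂).snd).symm

theorem Channel.thresholdFailure_block (P₁ : ProbDist X₁) (P₂ : ProbDist X₂) (θ : ℝ) :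
    (W.block n).thresholdFailure (ProbDist.pi fun _ => P₁) (ProbDist.pi fun _ => P₂) θ =
      (ProbDist.pi fun _ : Fin n => W.lawAtUser2 P₁ P₂).prob
        {z | ∏ i, (W (z i).2.1 (z i).1).snd.1 (z i).2.2 ≤
          θ * ∏ i, (P₁.bind fun x₁ => (W x₁ (z i).1).snd).1 (z i).2.2} := by
  let S (x₂ : Fin n → X₂) (x₁ : Fin n → X₁) : Set (Fin n → Y₂) :=
    {y₂ | ∏ i, (W (x₁ i) (x₂ i)).snd.1 (y₂ i) ≤
      θ * ∏ i, (P₁.bind fun x₁ => (W x₁ (x₂ i)).snd).1 (y₂ i)}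
  have hbind (x₂ : Fin n → X₂) :
      ((ProbDist.pi fun _ => P₁).bind fun x₁ => ProbDist.pi fun i => (W (x₁ i) (x₂ i)).snd) =
        ProbDist.pi fun i => P₁.bind fun x₁ => (W x₁ (x₂ i)).snd :=
    ProbDist.bind_pi (fun _ => P₁) fun i x₁ => (W x₁ (x₂ i)).snd
  calc (W.block n).thresholdFailure (ProbDist.pi fun _ => P₁) (ProbDist.pi fun _ => P₂) θ
      = (ProbDist.pi fun _ => P₂).expect fun x₂ => (ProbDist.pi fun _ => P₁).expect fun x₁ =>
          (ProbDist.pi fun i => (W (x₁ i) (x₂ i)).snd).prob (S x₂ x₁) := by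
        simp only [Channel.thresholdFailure, TWC.thresholdFailure, W.snd_block, hbind]
        rfl
    _ = (ProbDist.pi fun _ => P₂).expect fun x₂ =>
          (ProbDist.pi fun i => P₁.joint fun x₁ => (W x₁ (x₂ i)).snd).expect fun z =>
            (S x₂ fun i => (z i).1).indicator 1 fun i => (z i).2 :=
        ProbDist.expect_congr fun x₂ _ => ProbDist.expect_pi_joint (fun _ => P₁)
          (fun i x₁ => (W x₁ (x₂ i)).snd) fun x₁ => (S x₂ x₁).indicator 1
    _ = _ := ProbDist.expect_pi_joint (fun _ => P₂)
          (fun _ x₂ => P₁.joint fun x₁ => (W x₁ x₂).snd) fun x₂ z =>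
            (S x₂ fun i => (z i).1).indicator 1 fun i => (z i).2

theorem Channel.thresholdFailure_block_le (P₁ : ProbDist X₁) (P₂ : ProbDist X₂) (t : ℝ) :
    (W.block n).thresholdFailure (ProbDist.pi fun _ => P₁) (ProbDist.pi fun _ => P₂)
        (2 ^ (n * t)) ≤
      (ProbDist.pi fun _ : Fin n => W.lawAtUser2 P₁ P₂).prob
        {z | ∑ i, W.infoDensity P₁ (z i) ≤ n * t} := by
  rw [W.thresholdFailure_block]
  refine ProbDist.prob_mono fun z hz hprod => ?_
  have hne := ProbDist.apply_ne_zero_of_pi hz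
  have hcond (i : Fin n) : (W (z i).2.1 (z i).1).snd.1 (z i).2.2 ≠ 0 :=
    right_ne_zero_of_mul (right_ne_zero_of_mul (hne i))
  have hout (i : Fin n) : (P₁.bind fun x₁ => (W x₁ (z i).1).snd).1 (z i).2.2 ≠ 0 :=
    ProbDist.bind_apply_ne_zero (left_ne_zero_of_mul (right_ne_zero_of_mul (hne i))) (hcond i)
  have hout_pos : 0 < ∏ i, (P₁.bind fun x₁ => (W x₁ (z i).1).snd).1 (z i).2.2 :=
    Finset.prod_pos fun i _ => ((ProbDist.bind _ _).2.1 _).lt_of_ne' (hout i)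
  have hcond_pos : 0 < ∏ i, (W (z i).2.1 (z i).1).snd.1 (z i).2.2 :=
    Finset.prod_pos fun i _ => ((W _ _).snd.2.1 _).lt_of_ne' (hcond i)
  change ∑ i, Real.logb 2 _ ≤ _
  rw [← Real.logb_prod _ _ fun i _ => div_ne_zero (hcond i) (hout i), Finset.prod_div_distrib,
    Real.logb_le_iff_le_rpow one_lt_two (div_pos hcond_pos hout_pos), div_le_iff₀ hout_pos]
  exact hprod

theorem Channel.tendsto_thresholdFailure_block (P₁ : ProbDist X₁) (P₂ : ProbDist X₂) {t : ℝ}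
    (ht : t < infoX1Y2 (P₁.prod P₂) W) :
    Tendsto (fun n : ℕ => (W.block n).thresholdFailure (ProbDist.pi fun _ => P₁)
      (ProbDist.pi fun _ => P₂) (2 ^ (n * t))) atTop (𝓝 0) := by
  rw [← W.expect_infoDensity] at ht
  refine squeeze_zero (fun n => ?_) (fun n => W.thresholdFailure_block_le P₁ P₂ t)
    (ProbDist.tendsto_prob_pi_sum_le _ _ ht)
  rw [W.thresholdFailure_block]
  exact ProbDist.prob_nonneg _ _

end Block

section Achievability

/-- The case `R = 0` is separate because `I` may be `0`; there is then only one message. -/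
theorem exists_threshold {R I : ℝ} (h : R = 0 ∨ 0 ≤ R ∧ R < I) :
    ∃ t < I, Tendsto (fun n : ℕ => ((numMessages n R : ℝ) - 1) * ((2 : ℝ) ^ (n * t))⁻¹)
      atTop (𝓝 0) := by
  rcases h with rfl | ⟨hR, hRI⟩
  · exact ⟨I - 1, sub_one_lt I, by
      simp only [numMessages, mul_zero, Real.rpow_zero, Nat.floor_one, Nat.cast_one, sub_self,
        zero_mul, tendsto_const_nhds]⟩
  · refine ⟨(R + I) / 2, by linarith, ?_⟩
    have hgeom : Tendsto (fun n : ℕ => ((2 : ℝ) ^ (-((I - R) / 2))) ^ n) atTop (𝓝 0) :=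
      tendsto_pow_atTop_nhds_zero_of_lt_one (by positivity)
        (Real.rpow_lt_one_of_one_lt_of_neg one_lt_two (by linarith))
    refine squeeze_zero (fun n => ?_) (fun n => ?_) hgeom
    · have hM : (1 : ℝ) ≤ numMessages n R :=
        Nat.one_le_cast.2 (Fin.pos_iff_nonempty.2 (nonempty_fin_numMessages n hR))
      exact mul_nonneg (sub_nonneg.2 hM) (by positivity)
    · have hM : (numMessages n R : ℝ) - 1 ≤ (2 : ℝ) ^ ((n : ℝ) * R) :=
        (sub_le_self _ zero_le_one).trans (Nat.floor_le (by positivity))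
      refine (mul_le_mul_of_nonneg_right hM (by positivity)).trans_eq ?_
      rw [← Real.rpow_neg two_pos.le, ← Real.rpow_natCast, ← Real.rpow_mul two_pos.le,
        ← Real.rpow_add two_pos]
      ring_nf

variable {X₁ X₂ Y₁ Y₂ : Type*} [Fintype Y₁] [Fintype Y₂] {n : ℕ} {R₁ R₂ : ℝ}

/-- The code without feedback which is given by two codebooks and two decoding functions. -/
def Code.ofCodebooks (C₁ : Fin (numMessages n R₁) → Fin n → X₁)
    (C₂ : Fin (numMessages n R₂) → Fin n → X₂)
    (dec₁ : Fin (numMessages n R₁) → (Fin n → Y₁) → Fin (numMessages n R₂))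
    (dec₂ : Fin (numMessages n R₂) → (Fin n → Y₂) → Fin (numMessages n R₁)) :
    Code X₁ X₂ Y₁ Y₂ n R₁ R₂ where
  enc₁ i m _ := C₁ m i
  enc₂ i m _ := C₂ m i
  dec₁ := dec₁
  dec₂ := dec₂

variable [Fintype X₁] [Fintype X₂] (W : Channel X₁ X₂ Y₁ Y₂) (P₁ : ProbDist X₁) (P₂ : ProbDist X₂)

theorem Code.exists_errorProb_le (hR₁ : 0 ≤ R₁) (hR₂ : 0 ≤ R₂) (t s : ℝ) (n : ℕ) :
    ∃ c : Code X₁ X₂ Y₁ Y₂ n R₁ R₂, c.errorProb W ≤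
      ((W.block n).thresholdFailure (ProbDist.pi fun _ => P₁) (ProbDist.pi fun _ => P₂)
          (2 ^ (n * t)) + ((numMessages n R₁ : ℝ) - 1) * ((2 : ℝ) ^ (n * t))⁻¹) +
        ((W.swap.block n).thresholdFailure (ProbDist.pi fun _ => P₂) (ProbDist.pi fun _ => P₁)
          (2 ^ (n * s)) + ((numMessages n R₂ : ℝ) - 1) * ((2 : ℝ) ^ (n * s))⁻¹) := by
  have := nonempty_fin_numMessages n hR₁
  have := nonempty_fin_numMessages n hR₂
  obtain ⟨C₁, C₂, hC⟩ := (W.block n).exists_codebooks (M₁ := Fin (numMessages n R₁))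
    (M₂ := Fin (numMessages n R₂)) (ProbDist.pi fun _ => P₁) (ProbDist.pi fun _ => P₂)
    (Real.rpow_pos_of_pos two_pos (n * t)) (Real.rpow_pos_of_pos two_pos (n * s))
  rw [Fintype.card_fin, Fintype.card_fin, W.swap_block] at hC
  refine ⟨Code.ofCodebooks C₁ C₂
    ((W.swap.block n).decoder (ProbDist.pi fun _ => P₂) (2 ^ (n * s)) C₂ C₁)
    ((W.block n).decoder (ProbDist.pi fun _ => P₁) (2 ^ (n * t)) C₁ C₂), ?_⟩
  rw [Code.errorProb_eq_prob]
  exact hC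

theorem achievable_of_lt_info {R : ℝ × ℝ}
    (h₁ : R.1 = 0 ∨ 0 ≤ R.1 ∧ R.1 < infoX1Y2 (P₁.prod P₂) W)
    (h₂ : R.2 = 0 ∨ 0 ≤ R.2 ∧ R.2 < infoX2Y1 (P₁.prod P₂) W) : Achievable W R := by
  have hR₁ : 0 ≤ R.1 := h₁.elim (fun h => h.ge) And.left
  have hR₂ : 0 ≤ R.2 := h₂.elim (fun h => h.ge) And.left
  obtain ⟨t, ht, hMt⟩ := exists_threshold h₁
  obtain ⟨s, hs, hMs⟩ := exists_threshold h₂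
  rw [infoX2Y1_eq_infoX1Y2_swap, ProbDist.swap_prod] at hs
  choose c hc using Code.exists_errorProb_le W P₁ P₂ hR₁ hR₂ t s
  refine ⟨hR₁, hR₂, c, squeeze_zero (fun n => ?_) hc ?_⟩
  · have := nonempty_fin_numMessages n hR₁
    have := nonempty_fin_numMessages n hR₂
    rw [Code.errorProb_eq_prob]
    exact ProbDist.prob_nonneg _ _
  · simpa only [add_zero] using ((W.tendsto_thresholdFailure_block P₁ P₂ ht).add hMt).add
      ((W.swap.tendsto_thresholdFailure_block P₂ P₁ hs).add hMs)

theorem rateRegion_prod_subset_closure :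
    rateRegion (P₁.prod P₂) W ⊆ closure {R | Achievable W R} := by
  rintro R ⟨hR₁, hR₂, hI₁, hI₂⟩
  have hlim : Tendsto (fun s : ℝ => s • R) (𝓝[<] 1) (𝓝 R) := by
    have hcont : Continuous fun s : ℝ => s • R := continuous_id.smul continuous_const
    exact (hcont.tendsto' 1 R (one_smul ℝ R)).mono_left nhdsWithin_le_nhds
  refine mem_closure_of_tendsto hlim ?_
  filter_upwards [Ioo_mem_nhdsLT (zero_lt_one' ℝ)] with s hs
  have hscale {r I : ℝ} (hr : 0 ≤ r) (hrI : r ≤ I) : s * r = 0 ∨ 0 ≤ s * r ∧ s * r < I := by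
    rcases hr.eq_or_lt with rfl | hr
    · exact Or.inl (mul_zero s)
    · exact Or.inr ⟨mul_nonneg hs.1.le hr.le, (mul_lt_of_lt_one_left hr hs.2).trans_le hrI⟩
  exact achievable_of_lt_info W P₁ P₂ (hscale hR₁ hI₁) (hscale hR₂ hI₂)

theorem innerBound_subset_capacityRegion : innerBound W ⊆ capacityRegion W :=
  coBar_subset_coBar <| Set.iUnion₂_subset fun P₁ P₂ =>
    (rateRegion_prod_subset_closure W P₁ P₂).trans (closure_mono (subset_convexHull ℝ _))

end Achievability

end TWC

theorem theorem4 {X₁ X₂ Y₁ Y₂ : Type*} [Fintype X₁] [Fintype X₂] [Fintype Y₁] [Fintype Y₂]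
    (W : TWC.Channel X₁ X₂ Y₁ Y₂) (Pstar : TWC.ProbDist X₁)
    -- (i): a common maximizer of `I(X₁; Y₂ | X₂ = x₂)` over `P_{X₁|X₂=x₂}`, for all `x₂`
    (hmax : ∀ (x₂ : X₂) (Q : TWC.ProbDist X₁),
      TWC.mutualInfo Q.1 (fun x₁ => W.toUser2 x₁ x₂) ≤
        TWC.mutualInfo Pstar.1 (fun x₁ => W.toUser2 x₁ x₂))
    -- (ii), first part: `H(Y₁ | X₁, X₂)` does not depend on `P_{X₁|X₂}`, given `P_{X₂}`
    (hinv : ∀ P Q : TWC.ProbDist (X₁ × X₂), P.snd = Q.snd →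
      TWC.entropyY1X1X2 P W = TWC.entropyY1X1X2 Q W)
    -- (ii), second part
    (hent : ∀ P : TWC.ProbDist (X₁ × X₂),
      TWC.entropyY1X1 P W ≤ TWC.entropyY1X1 (Pstar.prod P.snd) W) :
    TWC.capacityRegion W = TWC.innerBound W ∧
      TWC.innerBound W = TWC.outerBound W ∧
      TWC.capacityRegion W =
        TWC.coBar (⋃ P₂ : TWC.ProbDist X₂, TWC.rateRegion (Pstar.prod P₂) W) := by
  have hIC := TWC.innerBound_subset_capacityRegion W
  have hCO := TWC.capacityRegion_subset_outerBound W
  have hOS : TWC.outerBound W ⊆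
      TWC.coBar (⋃ P₂ : TWC.ProbDist X₂, TWC.rateRegion (Pstar.prod P₂) W) :=
    TWC.coBar_subset_coBar <| Set.iUnion_subset fun P =>
      have hH := hinv P (Pstar.prod P.snd) (TWC.ProbDist.snd_prod _ _).symm
      (TWC.rateRegion_subset_rateRegion (TWC.infoX1Y2_le_of_maximizer hmax P)
        (TWC.infoX2Y1_le_of_entropy_le (hent P) hH)).trans <|
        (Set.subset_iUnion (fun P₂ => TWC.rateRegion (Pstar.prod P₂) W) P.snd).trans
          (TWC.subset_coBar _)
  have hSI : TWC.coBar (⋃ P₂ : TWC.ProbDist X₂, TWC.rateRegion (Pstar.prod P₂) W) ⊆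
      TWC.innerBound W :=
    TWC.coBar_subset_coBar <| Set.iUnion_subset fun P₂ =>
      (Set.subset_iUnion₂ (s := fun P₁ P₂ => TWC.rateRegion (TWC.ProbDist.prod P₁ P₂) W)
        Pstar P₂).trans (TWC.subset_coBar _)
  exact ⟨(hCO.trans (hOS.trans hSI)).antisymm hIC,
    (hIC.trans hCO).antisymm (hOS.trans hSI), (hCO.trans hOS).antisymm (hSI.trans hIC)⟩
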